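/- Let $d\ge 1$, $T>0$, and let $\mathbb T^d=(\mathbb R/T\mathbb Z)^d$ be the flat torus with Lebesgue measure $dx$. For a measurable $f$ and a positive measure $m$, $\int f\,dm:=\int f^+dm-\int f^-dm\in[-\infty,\infty]$, with $\infty-\infty:=-\infty$. Let $g:\mathbb T^d\to[-\infty,\infty]$ be real valued on $\mathbb T^d\setminus\{0\}$ (the value $g(0)=+\infty$ is allowed) and write $\mathcal E(\mu)=\iint g(x-y)\,d\mu(x)\,d\mu(y)$. Assume: 1. $g(-x)=g(x)$ for all $x$; 2. $g\in L^1(\mathbb T^d)$; 3. for every $\epsilon>0$, $g$ is uniformly continuous on $\mathbb T^d\setminus B(0,\epsilon)$; 4. $\mathcal E(\nu)\ge 0$ for every finite signed measure $\nu$ on $\mathbb T^d$ with $\nu(\mathbb T^d)=0$ for which the double integral defining $\mathcal E(\nu)$ converges absolutely (i.e. $g(x-y)$ is integrable with respect to $|\nu|\otimes|\nu|$); 5. $\mathcal E(\mu)>-\infty$ for every probability measure $\mu$ on $\mathbb T^d$. Let $V:\mathbb T^d\to\mathbb R$ be lower semicontinuous with $V\in L^1(\mathbb T^d)$, and let $\theta>0$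 be fixed. For a probability measure $\mu$ on $\mathbb T^d$ let $$\mathcal E^\theta_V(\mu)=\mathcal E(\mu)+\int_{\mathbb T^d}V\,d\mu+\frac1\theta\,\mathrm{ent}[\mu],$$ where $\mathrm{ent}[\mu]=\int_{\mathbb T^d}\log\frac{d\mu}{dx}\,d\mu$ if $\mu$ is absolutely continuous with respect to $dx$ and $\mathrm{ent}[\mu]=+\infty$ otherwise. For $N\ge 1$ and $\beta>0$ let $$\mathcal H_N(X_N)=\sum_{i\ne j}g(x_i-x_j)+N\sum_{i=1}^N V(x_i)\quad(\text{sum over ordered pairs}),\qquad Z_{N,\beta}=\int_{(\mathbb T^d)^N}e^{-\beta\mathcal H_N(X_N)}\,dX_N .$$ Then $\mathcal E^\theta_V$ attains its minimum over the probability measures on $\mathbb T^d$, and for every minimizer $\mu_\theta$, setting $\beta=\theta/N$, the next-order partition function $$K_{N,\beta}=\frac{Z_{N,\beta}}{\exp\left(-N^2\beta\,\mathcal E^\theta_V(\mu_\theta)\right)}$$ satisfies $$\lim_{N\to\infty}\frac{\log K_{N,\beta}}{N}=0 .$$ -/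

import Mathlib

open MeasureTheory Filter Topology

/-- The `d`-dimensional flat torus of side length `T`. Its `volume` is Lebesgue measure, of total
mass `T ^ d`. -/
abbrev Torus (d : ℕ) (T : ℝ) : Type := Fin d → AddCircle T

noncomputable section

/-- The integral of an extended-real function: integral of the positive part minus integral of the
negative part. In `EReal` one has `⊤ - ⊤ = ⊥`, so the value is `> ⊥` exactly when the negative
part has finite integral. -/
def erealIntegral {α : Type*} [MeasurableSpace α] (μ : Measure α) (f : α → EReal) : EReal :=
  ((∫⁻ x, (f x).toENNReal ∂μ : ENNReal) : EReal) -
    ((∫⁻ x, (-f x).toENNReal ∂μ : ENNReal) : EReal)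

variable {d : ℕ} {T : ℝ} [Fact (0 < T)]

/-- The mutual interaction `∬ g(x - y) dμ(x) dν(y)`. -/
def mutualEnergy (g : Torus d T → EReal) (μ ν : Measure (Torus d T)) : EReal :=
  erealIntegral (μ.prod ν) (fun p => g (p.1 - p.2))

/-- The self-interaction `𝓔(μ) = ∬ g(x - y) dμ(x) dμ(y)` of a positive measure. -/
def selfEnergy (g : Torus d T → EReal) (μ : Measure (Torus d T)) : EReal :=
  mutualEnergy g μ μ

/-- The double integral `∬ g(x - y) dν(x) dν(y)` converges absolutely for the signed measure `ν`,
that is, `g(x - y)` is integrable for `|ν| ⊗ |ν|`. -/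
def HasFiniteSignedEnergy (g : Torus d T → EReal) (ν : SignedMeasure (Torus d T)) : Prop :=
  ∫⁻ p, (g (p.1 - p.2)).abs ∂(ν.totalVariation.prod ν.totalVariation) < ⊤

/-- The self-interaction `∬ g(x - y) dν(x) dν(y)` of a signed measure `ν = ν⁺ - ν⁻` (used only when
the double integral converges absolutely). -/
def signedEnergy (g : Torus d T → EReal) (ν : SignedMeasure (Torus d T)) : EReal :=
  let p := ν.toJordanDecomposition.posPart
  let n := ν.toJordanDecomposition.negPart
  mutualEnergy g p p + mutualEnergy g n n - mutualEnergy g p n - mutualEnergy g n p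

/-- The assumptions on the pair interaction. It is real valued away from the origin; the value
`g 0 = ⊤` is allowed, as for Coulomb and Riesz kernels. -/
structure IsAdmissibleInteraction (g : Torus d T → EReal) : Prop where
  finite_off_zero : ∀ x, x ≠ 0 → g x ≠ ⊤ ∧ g x ≠ ⊥
  symmetric : ∀ x, g (-x) = g x
  integrable : ∫⁻ x, (g x).abs < ⊤
  uniformContinuous : ∀ ε : ℝ, 0 < ε →
    UniformContinuousOn (fun x => (g x).toReal) (Metric.ball (0 : Torus d T) ε)ᶜ
  weakly_positive_definite : ∀ ν : SignedMeasure (Torus d T), ν Set.univ = 0 →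
    HasFiniteSignedEnergy g ν → 0 ≤ signedEnergy g ν
  energy_gt_bot : ∀ μ : ProbabilityMeasure (Torus d T), ⊥ < selfEnergy g (μ : Measure (Torus d T))

/-- The assumptions on the confining potential: lower semicontinuous and integrable. -/
structure IsAdmissiblePotential (V : Torus d T → ℝ) : Prop where
  lowerSemicontinuous : LowerSemicontinuous V
  integrable : Integrable V volume

open scoped Classical in
/-- The entropy `ent[μ] = ∫ log (dμ/dx) dμ` if `μ` is absolutely continuous with respect to Lebesgue
measure, and `∞` otherwise. -/
def entropy (μ : Measure (Torus d T)) : EReal :=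
  if μ ≪ (volume : Measure (Torus d T)) then
    erealIntegral μ (fun x => ENNReal.log (μ.rnDeriv volume x))
  else ⊤

/-- The mean-field energy `𝓔_V(μ) = 𝓔(μ) + ∫ V dμ`. -/
def meanFieldEnergy (g : Torus d T → EReal) (V : Torus d T → ℝ) (μ : Measure (Torus d T)) :
    EReal :=
  selfEnergy g μ + erealIntegral μ (fun x => (V x : EReal))

/-- The thermal energy `𝓔_V^θ(μ) = 𝓔_V(μ) + (1/θ) ent[μ]`. -/
def thermalEnergy (g : Torus d T → EReal) (V : Torus d T → ℝ) (θ : ℝ) (μ : Measure (Torus d T)) :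
    EReal :=
  meanFieldEnergy g V μ + ((1 / θ : ℝ) : EReal) * entropy μ

/-- `μ` is a thermal equilibrium measure: a minimizer of `𝓔_V^θ` over all probability measures. -/
def IsThermalEquilibrium (g : Torus d T → EReal) (V : Torus d T → ℝ) (θ : ℝ)
    (μ : ProbabilityMeasure (Torus d T)) : Prop :=
  ∀ ν : ProbabilityMeasure (Torus d T),
    thermalEnergy g V θ (μ : Measure (Torus d T)) ≤ thermalEnergy g V θ (ν : Measure (Torus d T))

/-- The Hamiltonian `∑_{i ≠ j} g(x_i - x_j) + N ∑_i V(x_i)`; the first sum runs over ordered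
pairs. -/
def hamiltonian (g : Torus d T → EReal) (V : Torus d T → ℝ) (N : ℕ) (X : Fin N → Torus d T) :
    EReal :=
  ∑ p ∈ (Finset.univ : Finset (Fin N)).offDiag, g (X p.1 - X p.2) +
    ((N * ∑ i, V (X i) : ℝ) : EReal)

/-- The partition function `Z_{N,β} = ∫ exp(-β H_N(X)) dX`, with `exp(-∞) = 0`. -/
def partitionFunction (g : Torus d T → EReal) (V : Torus d T → ℝ) (N : ℕ) (β : ℝ) : ENNReal :=
  ∫⁻ X : Fin N → Torus d T, EReal.exp (-((β : EReal) * hamiltonian g V N X))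

/-- The next-order partition function `K_{N,β} = Z_{N,β} / exp(-N² β 𝓔_V^θ(μ))` with `θ = N β`
(`μ` being the thermal equilibrium measure). -/
def nextOrderPartitionFunction (g : Torus d T → EReal) (V : Torus d T → ℝ)
    (μ : ProbabilityMeasure (Torus d T)) (N : ℕ) (β : ℝ) : ENNReal :=
  partitionFunction g V N β /
    EReal.exp (-((((N : ℝ) ^ 2 * β : ℝ) : EReal) *
      thermalEnergy g V (N * β) (μ : Measure (Torus d T))))

end

open scoped ENNReal NNReal
open InformationTheory (klFun klFun_nonneg measurable_klFun continuous_klFun klFun_apply klFun_one)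

/-! ### Scalar inequalities for `klFun` -/

section KLFun

/-! The theorem reduces to a statement about nonnegative functionals. The assumption that no
probability measure has energy `-∞` forces `g ≥ -C` for some constant `C`
(`IsAdmissibleInteraction.exists_lower_bound`). Let `π` be the probability measure `exp (-θ V) dx /
c`. For `μ = f π` the thermal energy is `1/θ` times `freeEnergy k π f` plus a constant, where `k = θ
(g + C)` and the free energy adds `∫ klFun f dπ` to the interaction (`thermalEnergy_eq_freeEnergy`).
Measures that are not absolutely continuous have energy `⊤`. In the same way `Z` is an explicit
factor times `gibbsPartition k π N` (`partitionFunction_eq`). It remains to minimize the free energy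
and to show that `log (gibbsPartition k π N) / N` tends to minus the minimum.

Existence of a minimizer (`exists_freeEnergy_minimizer`): positive definiteness makes the
interaction midpoint convex on bounded densities, and the entropy is strongly convex in the
Hellinger distance. Hence the square roots of a bounded minimizing sequence are Cauchy in `L²`, and
Fatou's lemma applied along a subsequence shows that the squared limit is a minimizer.

Lower bound for the partition function (`boltzmann_le_gibbsPartition`): the Gibbs variational
principle tested with the product measure `(f π)^N`.

Upper bound (`gibbsPartition_step_le`, `log_gibbsPartition_le`): a step kernel below `k` depends
only on the numbers of points in finitely many cells. There are polynomially many such counts, and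
each contributes at most `exp (-N inf + B)`, where `inf` is the infimum of the step free energy and
`B` bounds the step kernel.

Both arguments rest on `exists_bounded_density`: a density of bounded free energy can be truncated
at a level depending only on the bound and the tolerance, at small cost. This supplies the bounded
minimizing sequence. It also shows that an `L¹`-small change from `k` to a step kernel lowers the
minimum only slightly, since a bounded density sees an `L¹` error only through the square of its
bound. -/

lemma mul_log_sub_mul_log_le {a s : ℝ} (ha : 0 ≤ a) (hs : 0 < s) :
    a * Real.log s - a * Real.log a ≤ 2 * (√a * √s) - 2 * a := by
  rcases ha.eq_or_lt with rfl | ha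
  · simp
  have h1 : Real.log (√s / √a) ≤ √s / √a - 1 :=
    Real.log_le_sub_one_of_pos (by positivity)
  rw [Real.log_div (by positivity) (by positivity), Real.log_sqrt hs.le, Real.log_sqrt ha.le] at h1
  have h2 : a * (√s / √a) = √a * √s := by
    have : √a ≠ 0 := by positivity
    field_simp
    rw [Real.sq_sqrt ha.le]
  nlinarith [mul_le_mul_of_nonneg_left h1 ha.le]

/-- Applying `log t ≤ t - 1` at `t = √(s/a)` and `t = √(s/b)`, with `s` the midpoint, leaves exactly
the square of `√a + √b - 2√s`. The gain `(√a - √b)²` is what later gives the Cauchy property in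
Hellinger distance. -/
lemma klFun_midpoint_add_le {a b : ℝ} (ha : 0 ≤ a) (hb : 0 ≤ b) :
    klFun ((a + b) / 2) + (√a - √b) ^ 2 / 4 ≤ (klFun a + klFun b) / 2 := by
  rcases (add_nonneg ha hb).eq_or_lt with h | h
  · have h1 : a = 0 := by linarith
    have h2 : b = 0 := by linarith
    subst h1; subst h2; simp
  set s := (a + b) / 2 with hs
  have hs0 : 0 < s := by positivity
  have h1 := mul_log_sub_mul_log_le ha hs0
  have h2 := mul_log_sub_mul_log_le hb hs0
  have ea := Real.sq_sqrt ha
  have eb := Real.sq_sqrt hb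
  have es := Real.sq_sqrt hs0.le
  simp only [klFun_apply]
  have h3 : s * Real.log s = (a * Real.log s + b * Real.log s) / 2 := by rw [hs]; ring
  have h4 : a + b = 2 * s := by rw [hs]; ring
  nlinarith [sq_nonneg (√a + √b - 2 * √s)]

lemma klFun_min_le {a M : ℝ} (ha : 0 ≤ a) (hM : 1 ≤ M) : klFun (min a M) ≤ klFun a := by
  rcases le_total a M with h | h
  · rw [min_eq_left h]
  rw [min_eq_right h]
  have hM0 : 0 < M := by linarith
  have ha0 : 0 < a := by linarith
  have h1 : Real.log (M / a) ≤ M / a - 1 := Real.log_le_sub_one_of_pos (by positivity)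
  rw [Real.log_div hM0.ne' ha0.ne'] at h1
  have h2 : a * (M / a) = M := by field_simp
  have h3 := Real.log_nonneg hM
  simp only [klFun_apply]
  nlinarith [mul_le_mul_of_nonneg_left h1 ha, mul_nonneg (sub_nonneg.2 h) h3]

/-- The only estimate is `log (1/m) ≤ 1/m - 1`. When `a` is a density of total mass `m`, the
quotient `a / m` integrates to one, so the two terms with `1/m - 1` cancel and normalizing costs
only a factor `1/m` in entropy. -/
lemma klFun_div_add_le {a m : ℝ} (ha : 0 ≤ a) (hm : 0 < m) :
    klFun (a / m) + (1 / m - 1) ≤ klFun a / m + (1 / m - 1) * (a / m) := by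
  have h1 : Real.log (1 / m) ≤ 1 / m - 1 := Real.log_le_sub_one_of_pos (by positivity)
  rw [Real.log_div one_ne_zero hm.ne', Real.log_one] at h1
  have h2 := mul_le_mul_of_nonneg_left h1 (div_nonneg ha hm.le)
  simp only [klFun_apply]
  rcases ha.eq_or_lt with rfl | ha
  · simp
  rw [Real.log_div ha.ne' hm.ne']
  have h3 : (a * Real.log a + 1 - a) / m = a / m * Real.log a + 1 / m - a / m := by ring
  rw [h3]
  linarith

/-- Superlinear growth: each unit of mass above the level `M` costs entropy at least `log M - 1`.
Bounded entropy therefore forces a high truncation to keep nearly all the mass. -/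
lemma sub_min_mul_le_klFun {a M : ℝ} (ha : 0 ≤ a) (hM : 1 ≤ Real.log M) (hM0 : 0 < M) :
    (a - min a M) * (Real.log M - 1) ≤ klFun a := by
  rcases le_total a M with h | h
  · rw [min_eq_left h]; simpa using klFun_nonneg ha
  rw [min_eq_right h]
  have h1 := Real.log_le_log hM0 h
  simp only [klFun_apply]
  nlinarith [mul_le_mul_of_nonneg_left h1 ha, mul_nonneg hM0.le (sub_nonneg.2 hM)]

end KLFun

/-! ### Free energy of densities and truncation -/

section FreeEnergy

variable {X : Type*} [MeasurableSpace X]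

/-- A measurable density with respect to `π`. -/
structure IsProbDensity (π : Measure X) (f : X → ℝ≥0) : Prop where
  measurable : Measurable f
  lintegral_eq_one : ∫⁻ x, (f x : ℝ≥0∞) ∂π = 1

/-- The mutual interaction of the measures with densities `f` and `h`. -/
noncomputable def interactionEnergy (k : X × X → ℝ≥0∞) (π : Measure X) (f h : X → ℝ≥0) : ℝ≥0∞ :=
  ∫⁻ p, k p * (f p.1 * h p.2) ∂(π.prod π)

/-- The relative entropy of the measure with density `f` with respect to `π`. -/
noncomputable def relEntropy (π : Measure X) (f : X → ℝ≥0) : ℝ≥0∞ :=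
  ∫⁻ x, ENNReal.ofReal (klFun (f x)) ∂π

/-- Interaction energy plus relative entropy. -/
noncomputable def freeEnergy (k : X × X → ℝ≥0∞) (π : Measure X) (f : X → ℝ≥0) : ℝ≥0∞ :=
  interactionEnergy k π f f + relEntropy π f

variable {π : Measure X} {f h : X → ℝ≥0} {k s r : X × X → ℝ≥0∞}

lemma measurable_ofReal_klFun (hf : Measurable f) :
    Measurable fun x => ENNReal.ofReal (klFun (f x)) :=
  (measurable_klFun.comp hf.coe_nnreal_real).ennreal_ofReal

lemma measurable_density_prod (hf : Measurable f) (hh : Measurable h) :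
    Measurable fun p : X × X => (f p.1 * h p.2 : ℝ≥0∞) :=
  (hf.comp measurable_fst).coe_nnreal_ennreal.mul (hh.comp measurable_snd).coe_nnreal_ennreal

lemma isProbDensity_one [IsProbabilityMeasure π] : IsProbDensity π fun _ => 1 :=
  ⟨measurable_const, by simp⟩

lemma freeEnergy_one : freeEnergy k π (fun _ => 1) = ∫⁻ p, k p ∂(π.prod π) := by
  simp [freeEnergy, interactionEnergy, relEntropy, klFun_one]

lemma relEntropy_div_le [IsProbabilityMeasure π] (hf : Measurable f) {m : ℝ≥0} (hm : m ≠ 0)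
    (hm1 : m ≤ 1) (hfm : ∫⁻ x, (f x : ℝ≥0∞) ∂π = m) :
    relEntropy π (fun x => f x / m) ≤ (m : ℝ≥0∞)⁻¹ * relEntropy π f := by
  have hm0 : (0 : ℝ) < m := by positivity
  have hc : (0 : ℝ) ≤ 1 / m - 1 := by
    rw [sub_nonneg, le_div_iff₀ hm0]; simpa using hm1
  have hle : ∫⁻ x, (ENNReal.ofReal (klFun ((f x / m : ℝ≥0) : ℝ)) + ENNReal.ofReal (1 / m - 1)) ∂π ≤
      ∫⁻ x, ((m : ℝ≥0∞)⁻¹ * ENNReal.ofReal (klFun (f x)) +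
        ENNReal.ofReal (1 / m - 1) * ((m : ℝ≥0∞)⁻¹ * f x)) ∂π := by
    refine lintegral_mono fun x => ?_
    have h1 := klFun_div_add_le (f x).coe_nonneg hm0
    have h2 : (m : ℝ≥0∞)⁻¹ = ENNReal.ofReal (1 / m) := by
      rw [one_div, ENNReal.ofReal_inv_of_pos hm0, ENNReal.ofReal_coe_nnreal]
    have h3 : (f x : ℝ≥0∞) = ENNReal.ofReal (f x) := by simp
    rw [h2, h3, ← ENNReal.ofReal_mul (by positivity), ← ENNReal.ofReal_mul (by positivity),
      ← ENNReal.ofReal_mul hc, ← ENNReal.ofReal_add (klFun_nonneg (by positivity)) hc,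
      ← ENNReal.ofReal_add (mul_nonneg (by positivity) (klFun_nonneg (by positivity)))
        (mul_nonneg hc (by positivity))]
    refine ENNReal.ofReal_le_ofReal ?_
    push_cast
    calc _ ≤ _ := h1
      _ = _ := by ring
  have hmi : (m : ℝ≥0∞) ≠ 0 := by simpa using hm
  rw [lintegral_add_right _ measurable_const,
    lintegral_add_left ((measurable_ofReal_klFun hf).const_mul _),
    lintegral_const_mul _ (measurable_ofReal_klFun hf),
    lintegral_const_mul _ (hf.coe_nnreal_ennreal.const_mul _),
    lintegral_const_mul _ hf.coe_nnreal_ennreal, hfm, ENNReal.inv_mul_cancel hmi (by simp)] at hle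
  simp only [lintegral_const, measure_univ, mul_one] at hle
  exact (ENNReal.add_le_add_iff_right ENNReal.ofReal_ne_top).1 hle

lemma relEntropy_min_le {M : ℝ≥0} (hM : 1 ≤ M) :
    relEntropy π (fun x => min (f x) M) ≤ relEntropy π f := by
  refine lintegral_mono fun x => ENNReal.ofReal_le_ofReal ?_
  simpa using klFun_min_le (f x).coe_nonneg (M := M) (by simpa using hM)

lemma le_relEntropy_add_lintegral_min (hf : IsProbDensity π f) {M : ℝ≥0}
    (hM : 1 ≤ Real.log M) (hM0 : 0 < M) :
    ENNReal.ofReal (Real.log M - 1) ≤ relEntropy π f +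
      ENNReal.ofReal (Real.log M - 1) * ∫⁻ x, (min (f x) M : ℝ≥0) ∂π := by
  have hmin : Measurable fun x => ((min (f x) M : ℝ≥0) : ℝ≥0∞) :=
    (hf.measurable.min measurable_const).coe_nnreal_ennreal
  rw [relEntropy, ← lintegral_const_mul _ hmin,
    ← lintegral_add_left (measurable_ofReal_klFun hf.measurable)]
  calc ENNReal.ofReal (Real.log M - 1)
      = ∫⁻ x, ENNReal.ofReal (Real.log M - 1) * f x ∂π := by
        rw [lintegral_const_mul _ hf.measurable.coe_nnreal_ennreal, hf.lintegral_eq_one, mul_one]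
    _ ≤ _ := by
        refine lintegral_mono fun x => ?_
        have h1 := sub_min_mul_le_klFun (f x).coe_nonneg hM (by exact_mod_cast hM0)
        have h3 : ∀ a : ℝ≥0, (a : ℝ≥0∞) = ENNReal.ofReal a := fun a => by simp
        have hc : 0 ≤ Real.log M - 1 := by linarith
        rw [h3, h3 (min _ _), ← ENNReal.ofReal_mul hc, ← ENNReal.ofReal_mul hc,
          ← ENNReal.ofReal_add (klFun_nonneg (by positivity)) (mul_nonneg hc (by positivity))]
        refine ENNReal.ofReal_le_ofReal ?_
        push_cast
        linarith

lemma interactionEnergy_div {m : ℝ≥0} (hm : m ≠ 0) :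
    interactionEnergy k π (fun x => f x / m) (fun x => f x / m) =
      ((m : ℝ≥0∞)⁻¹) ^ 2 * interactionEnergy k π f f := by
  have hmi : (m : ℝ≥0∞) ≠ 0 := by simpa using hm
  rw [interactionEnergy, interactionEnergy, ← lintegral_const_mul' _ _ (by simp [hm])]
  refine lintegral_congr fun p => ?_
  rw [ENNReal.coe_div hm, ENNReal.coe_div hm, div_eq_mul_inv, div_eq_mul_inv]
  ring

/-- The truncation is dropped against `s` and used as the bound `M` against `r`, so only the `L¹`
norm of the error `r` enters. -/
lemma interactionEnergy_min_le [SFinite π] (hs : Measurable s) (hf : Measurable f)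
    (hksr : ∀ᵐ p ∂(π.prod π), k p ≤ s p + r p) (M : ℝ≥0) :
    interactionEnergy k π (fun x => min (f x) M) (fun x => min (f x) M) ≤
      interactionEnergy s π f f + (M : ℝ≥0∞) ^ 2 * ∫⁻ p, r p ∂(π.prod π) := by
  rw [interactionEnergy, interactionEnergy, ← lintegral_const_mul' _ _ (by simp),
    ← lintegral_add_left (f := fun p => s p * (f p.1 * f p.2))
      (hs.mul (measurable_density_prod hf hf))]
  refine lintegral_mono_ae ?_
  filter_upwards [hksr] with p hp
  calc k p * ((min (f p.1) M : ℝ≥0) * (min (f p.2) M : ℝ≥0))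
      ≤ (s p + r p) * ((min (f p.1) M : ℝ≥0) * (min (f p.2) M : ℝ≥0)) := by gcongr
    _ = s p * ((min (f p.1) M : ℝ≥0) * (min (f p.2) M : ℝ≥0)) +
        r p * ((min (f p.1) M : ℝ≥0) * (min (f p.2) M : ℝ≥0)) := by ring
    _ ≤ s p * (f p.1 * f p.2) + r p * (M * M) := by
        gcongr
        · exact min_le_left _ _
        · exact min_le_left _ _
        · exact min_le_right _ _
        · exact min_le_right _ _
    _ = _ := by ring

/-- Truncating a density at a high level costs little free energy, uniformly over densities of
bounded free energy, even if the kernel is replaced by one that is larger by a small amount in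
`L¹`. -/
theorem exists_bounded_density [IsProbabilityMeasure π] (A η : ℝ≥0) (hη : 0 < η) :
    ∃ M τ : ℝ≥0, 0 < τ ∧ ∀ k s r : X × X → ℝ≥0∞, Measurable s →
      (∀ᵐ p ∂(π.prod π), k p ≤ s p + r p) → ∫⁻ p, r p ∂(π.prod π) ≤ τ →
      ∀ f : X → ℝ≥0, IsProbDensity π f → freeEnergy s π f ≤ A →
        ∃ ν : X → ℝ≥0, IsProbDensity π ν ∧ (∀ x, ν x ≤ M) ∧
          freeEnergy k π ν ≤ freeEnergy s π f + η := by
  -- `q` is the fraction of mass that must survive truncation. Renormalizing then multiplies the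
  -- energy by at most `q⁻²`, which costs at most `η / 2`.
  obtain ⟨q, hq0, hq1, hq⟩ : ∃ q : ℝ≥0, 0 < q ∧ q < 1 ∧ A * (q⁻¹ ^ 2) ≤ A + η / 2 := by
    have h1 : Tendsto (fun q : ℝ≥0 => A * (q⁻¹ ^ 2)) (𝓝[<] 1) (𝓝 (A * ((1 : ℝ≥0)⁻¹ ^ 2))) := by
      refine Tendsto.mono_left ?_ nhdsWithin_le_nhds
      exact (((tendsto_inv₀ (one_ne_zero)).pow 2).const_mul A)
    have h2 : A * ((1 : ℝ≥0)⁻¹ ^ 2) < A + η / 2 := by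
      simpa using hη
    have h3 : ∀ᶠ q : ℝ≥0 in 𝓝[<] 1, 0 < q :=
      (lt_mem_nhds one_pos).filter_mono nhdsWithin_le_nhds
    have : (𝓝[<] (1 : ℝ≥0)).NeBot := nhdsLT_neBot_of_exists_lt ⟨0, one_pos⟩
    obtain ⟨q, hq⟩ := ((h1.eventually_lt_const h2).and (h3.and self_mem_nhdsWithin)).exists
    exact ⟨q, hq.2.1, hq.2.2, hq.1.le⟩
  have hq1' : (0 : ℝ) < 1 - q := by simpa using hq1
  -- Chosen so that `A ≤ L (1 - q)`: at most `A / L ≤ 1 - q` of the mass can lie above the level.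
  -- The level `exp (L + 1)` gives `log M - 1 = L`.
  set L : ℝ := A / (1 - q) + 1 with hL
  have hL1 : 1 ≤ L := by rw [hL]; linarith [show (0 : ℝ) ≤ A / (1 - q) by positivity]
  set M : ℝ≥0 := ⟨Real.exp (L + 1), (Real.exp_pos _).le⟩ with hM
  have hlog : Real.log M = L + 1 := by rw [hM]; exact Real.log_exp _
  have hM1 : 1 ≤ M := by
    rw [← NNReal.coe_le_coe]; exact Real.one_le_exp (by linarith)
  have hM0 : 0 < M := zero_lt_one.trans_le hM1
  -- The truncation is divided by its mass `m ≥ q`, hence the bound `M / q`. The kernel error enters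
  -- as `q⁻² M² τ`, which this `τ` makes equal to `η / 2`.
  refine ⟨M / q, q ^ 2 * (η / 2) / M ^ 2, by positivity, fun k s r hs hksr hr f hf hfA => ?_⟩
  have hE := le_relEntropy_add_lintegral_min hf (M := M) (by rw [hlog]; linarith) hM0
  have hmle : ∫⁻ x, (min (f x) M : ℝ≥0) ∂π ≤ 1 := by
    rw [← hf.lintegral_eq_one]
    exact lintegral_mono fun x => ENNReal.coe_le_coe.2 (min_le_left _ _)
  obtain ⟨m, hm⟩ : ∃ m : ℝ≥0, ∫⁻ x, (min (f x) M : ℝ≥0) ∂π = m :=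
    ⟨_, (ENNReal.coe_toNNReal (hmle.trans_lt ENNReal.one_lt_top).ne).symm⟩
  have hm1 : m ≤ 1 := by rw [hm] at hmle; exact_mod_cast hmle
  have hqm : q ≤ m := by
    rw [hm, hlog, add_sub_cancel_right] at hE
    have h1 : relEntropy π f ≤ A := le_add_self.trans hfA
    have h2 : ENNReal.ofReal L ≤ ENNReal.ofReal (A + L * m) := by
      rw [ENNReal.ofReal_add (q := L * m) (by positivity) (by positivity),
        ENNReal.ofReal_mul (p := L) (by linarith)]
      simp only [ENNReal.ofReal_coe_nnreal]
      exact hE.trans (by gcongr)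
    rw [ENNReal.ofReal_le_ofReal_iff (by positivity)] at h2
    have h3 : (A : ℝ) ≤ L * (1 - q) := by
      rw [hL, add_mul, div_mul_cancel₀ _ hq1'.ne']; linarith
    have h4 : L * q ≤ L * m := by nlinarith
    have := le_of_mul_le_mul_left h4 (by linarith)
    exact_mod_cast this
  have hmpos : 0 < m := hq0.trans_le hqm
  have hmin : Measurable fun x => min (f x) M := hf.measurable.min measurable_const
  have hmE : (m : ℝ≥0∞) ≠ 0 := by simpa using hmpos.ne'
  have hinv1 : (m : ℝ≥0∞)⁻¹ ≤ (m : ℝ≥0∞)⁻¹ ^ 2 := by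
    have : 1 ≤ (m : ℝ≥0∞)⁻¹ := by rw [ENNReal.one_le_inv]; exact_mod_cast hm1
    rw [sq]; exact le_mul_of_one_le_left' this
  refine ⟨fun x => min (f x) M / m, ⟨hmin.div_const m, ?_⟩, fun x => ?_, ?_⟩
  · simp_rw [ENNReal.coe_div hmpos.ne', div_eq_mul_inv]
    rw [lintegral_mul_const _ hmin.coe_nnreal_ennreal, hm, ENNReal.mul_inv_cancel hmE (by simp)]
  · exact div_le_div₀ (by positivity) (min_le_right _ _) hq0 hqm
  · have hqE : (q : ℝ≥0∞) ≠ 0 := by simpa using hq0.ne'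
    have hinvq : (m : ℝ≥0∞)⁻¹ ≤ (q : ℝ≥0∞)⁻¹ := by
      rw [ENNReal.inv_le_inv]; exact_mod_cast hqm
    have hstep : freeEnergy k π (fun x => min (f x) M / m) ≤
        (q : ℝ≥0∞)⁻¹ ^ 2 * (freeEnergy s π f + (M : ℝ≥0∞) ^ 2 * ∫⁻ p, r p ∂(π.prod π)) := by
      calc freeEnergy k π (fun x => min (f x) M / m)
          ≤ (m : ℝ≥0∞)⁻¹ ^ 2 * (interactionEnergy s π f f +
              (M : ℝ≥0∞) ^ 2 * ∫⁻ p, r p ∂(π.prod π)) + (m : ℝ≥0∞)⁻¹ ^ 2 * relEntropy π f := by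
            refine add_le_add ?_ ?_
            · rw [interactionEnergy_div hmpos.ne']
              gcongr
              exact interactionEnergy_min_le hs hf.measurable hksr M
            · refine (relEntropy_div_le hmin hmpos.ne' hm1 hm).trans ?_
              gcongr
              exact relEntropy_min_le hM1
        _ = (m : ℝ≥0∞)⁻¹ ^ 2 * (freeEnergy s π f +
              (M : ℝ≥0∞) ^ 2 * ∫⁻ p, r p ∂(π.prod π)) := by rw [freeEnergy]; ring
        _ ≤ _ := by gcongr
    obtain ⟨F, hF⟩ : ∃ F : ℝ≥0, freeEnergy s π f = F :=
      ⟨_, (ENNReal.coe_toNNReal (hfA.trans_lt ENNReal.coe_lt_top).ne).symm⟩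
    rw [hF] at hfA hstep ⊢
    have hFA : F ≤ A := by exact_mod_cast hfA
    refine hstep.trans ?_
    have h1 : (q : ℝ≥0∞)⁻¹ ^ 2 * (F + (M : ℝ≥0∞) ^ 2 * ∫⁻ p, r p ∂(π.prod π)) ≤
        ((q⁻¹ ^ 2 * (F + M ^ 2 * (q ^ 2 * (η / 2) / M ^ 2)) : ℝ≥0) : ℝ≥0∞) := by
      push_cast [ENNReal.coe_inv hq0.ne']
      gcongr
    refine h1.trans ?_
    have h2 : q⁻¹ ^ 2 * (F + M ^ 2 * (q ^ 2 * (η / 2) / M ^ 2)) = F * q⁻¹ ^ 2 + η / 2 := by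
      have := hM0.ne'; have := hq0.ne'
      field_simp
    rw [h2]
    have h3 : F * q⁻¹ ^ 2 ≤ F + η / 2 := by
      have hq2 : 1 ≤ q⁻¹ ^ 2 := one_le_pow₀ ((one_le_inv₀ hq0).2 hq1.le)
      rw [← NNReal.coe_le_coe] at hq hFA hq2 ⊢
      push_cast at hq hFA hq2 ⊢
      nlinarith
    have h4 : F * q⁻¹ ^ 2 + η / 2 ≤ F + η := by
      calc _ ≤ F + η / 2 + η / 2 := by gcongr
        _ = F + η := by rw [add_assoc, add_halves]
    exact_mod_cast h4

end FreeEnergy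

/-! ### Existence of a free energy minimizer -/

section Minimizer

variable {X : Type*} [MeasurableSpace X]

lemma eLpNorm_two_sq (μ : Measure X) (u : X → ℝ) :
    eLpNorm u 2 μ ^ 2 = ∫⁻ x, ENNReal.ofReal (u x ^ 2) ∂μ := by
  have h := eLpNorm_nnreal_pow_eq_lintegral (f := u) (μ := μ) (p := 2) two_ne_zero
  simp only [NNReal.coe_ofNat, ENNReal.coe_ofNat, ENNReal.rpow_ofNat] at h
  rw [h]
  refine lintegral_congr fun x => ?_
  rw [← ofReal_norm, ← ENNReal.ofReal_pow (norm_nonneg _), Real.norm_eq_abs, sq_abs]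

lemma ofReal_sqrt_sq (a : ℝ≥0) : ENNReal.ofReal (√(a : ℝ) ^ 2) = a := by
  rw [Real.sq_sqrt a.coe_nonneg, ENNReal.ofReal_coe_nnreal]

variable {π : Measure X} {f h : X → ℝ≥0} {k : X × X → ℝ≥0∞}

lemma freeEnergy_eq_lintegral_prod [IsProbabilityMeasure π] (hf : Measurable f) :
    freeEnergy k π f = ∫⁻ p, (k p * (f p.1 * f p.2) +
      ENNReal.ofReal (klFun (f p.1))) ∂(π.prod π) := by
  rw [lintegral_add_right (g := fun p : X × X => ENNReal.ofReal (klFun (f p.1))) _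
      ((measurable_ofReal_klFun hf).comp measurable_fst), freeEnergy,
    interactionEnergy, relEntropy]
  congr 1
  exact (measurePreserving_fst.lintegral_comp (measurable_ofReal_klFun hf)).symm

/-- Fatou on the product space, with interaction and entropy in one nonnegative integrand.
Integrability makes `k` finite almost everywhere, which is needed because multiplication by `⊤` is
not continuous at `0`. -/
lemma freeEnergy_le_liminf [IsProbabilityMeasure π] (hk : Measurable k)
    (hkint : ∫⁻ p, k p ∂(π.prod π) ≠ ⊤) {F : ℕ → X → ℝ≥0} (hF : ∀ n, Measurable (F n))
    (hf : Measurable f) (hlim : ∀ᵐ x ∂π, Tendsto (fun n => F n x) atTop (𝓝 (f x))) :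
    freeEnergy k π f ≤ liminf (fun n => freeEnergy k π (F n)) atTop := by
  rw [freeEnergy_eq_lintegral_prod hf, show (fun n => freeEnergy k π (F n)) = _ from
    funext fun n => freeEnergy_eq_lintegral_prod (hF n)]
  refine le_trans (lintegral_mono_ae ?_) (lintegral_liminf_le fun n => ?_)
  · have h1 : ∀ᵐ p ∂(π.prod π), Tendsto (fun n => F n p.1) atTop (𝓝 (f p.1)) :=
      Measure.quasiMeasurePreserving_fst.ae hlim
    have h2 : ∀ᵐ p ∂(π.prod π), Tendsto (fun n => F n p.2) atTop (𝓝 (f p.2)) :=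
      Measure.quasiMeasurePreserving_snd.ae hlim
    filter_upwards [h1, h2, ae_lt_top hk hkint] with p hp1 hp2 hkp
    refine (Tendsto.liminf_eq ?_).ge
    refine Tendsto.add (ENNReal.Tendsto.const_mul ?_ (Or.inr hkp.ne)) ?_
    · have : Tendsto (fun n => F n p.1 * F n p.2) atTop (𝓝 (f p.1 * f p.2)) := hp1.mul hp2
      exact_mod_cast ENNReal.tendsto_coe.2 this
    · refine ENNReal.tendsto_ofReal ((continuous_klFun.tendsto _).comp ?_)
      exact NNReal.tendsto_coe.2 hp1
  · exact (hk.mul (measurable_density_prod (hF n) (hF n))).add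
      ((measurable_ofReal_klFun (hF n)).comp measurable_fst)

lemma IsProbDensity.midpoint (hf : IsProbDensity π f) (hh : IsProbDensity π h) :
    IsProbDensity π fun x => (f x + h x) / 2 := by
  refine ⟨(hf.measurable.add hh.measurable).div_const _, ?_⟩
  have : ∀ x, (((f x + h x) / 2 : ℝ≥0) : ℝ≥0∞) = (f x + h x) * 2⁻¹ := fun x => by
    rw [ENNReal.coe_div two_ne_zero, div_eq_mul_inv]; push_cast; rfl
  simp_rw [this]
  rw [lintegral_mul_const _ (by
      exact hf.measurable.coe_nnreal_ennreal.add hh.measurable.coe_nnreal_ennreal),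
    lintegral_add_left hf.measurable.coe_nnreal_ennreal, hf.lintegral_eq_one, hh.lintegral_eq_one,
    one_add_one_eq_two, ENNReal.mul_inv_cancel two_ne_zero (by simp)]

lemma interactionEnergy_midpoint (hk : Measurable k) (hf : Measurable f) (hh : Measurable h) :
    4 * interactionEnergy k π (fun x => (f x + h x) / 2) (fun x => (f x + h x) / 2) =
      interactionEnergy k π f f + interactionEnergy k π h h +
        (interactionEnergy k π f h + interactionEnergy k π h f) := by
  have hm : ∀ {a b : X → ℝ≥0}, Measurable a → Measurable b →
      Measurable fun p : X × X => k p * (a p.1 * b p.2 : ℝ≥0∞) := fun ha hb =>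
    hk.mul (measurable_density_prod ha hb)
  simp only [interactionEnergy]
  rw [← lintegral_const_mul' _ _ (by simp), ← lintegral_add_left (hm hf hf),
    ← lintegral_add_left (hm hf hh), ← lintegral_add_left
      (f := fun p => k p * (f p.1 * f p.2) + k p * (h p.1 * h p.2)) ((hm hf hf).add (hm hh hh))]
  refine lintegral_congr fun p => ?_
  have e : ∀ a b : ℝ≥0, (((a + b) / 2 : ℝ≥0) : ℝ≥0∞) = (a + b) * 2⁻¹ := fun a b => by
    rw [ENNReal.coe_div two_ne_zero, div_eq_mul_inv]; push_cast; rfl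
  rw [e, e]
  have h4 : (4 : ℝ≥0∞) * (2⁻¹ * 2⁻¹) = 1 := by
    rw [← ENNReal.mul_inv (by simp) (by simp), show (2 : ℝ≥0∞) * 2 = 4 by norm_num,
      ENNReal.mul_inv_cancel (by simp) (by simp)]
  calc _ = (4 * (2⁻¹ * 2⁻¹)) * (k p * ((f p.1 + h p.1) * (f p.2 + h p.2))) := by ring
    _ = _ := by rw [h4]; ring

lemma relEntropy_midpoint_add_le (hf : Measurable f) (hh : Measurable h) :
    2 * relEntropy π (fun x => (f x + h x) / 2) +
        2⁻¹ * ∫⁻ x, ENNReal.ofReal ((√(f x : ℝ) - √(h x : ℝ)) ^ 2) ∂π ≤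
      relEntropy π f + relEntropy π h := by
  simp only [relEntropy]
  have hm : Measurable fun x => (f x + h x) / 2 := (hf.add hh).div_const _
  rw [← lintegral_const_mul' _ _ (by simp), ← lintegral_const_mul' _ _ (by simp),
    ← lintegral_add_left ((measurable_ofReal_klFun hm).const_mul _),
    ← lintegral_add_left (measurable_ofReal_klFun hf)]
  refine lintegral_mono fun x => ?_
  have h1 := klFun_midpoint_add_le (f x).coe_nonneg (h x).coe_nonneg
  have e2 : (2 : ℝ≥0∞) = ENNReal.ofReal 2 := by simp
  have hn : ∀ a : ℝ≥0, 0 ≤ klFun a := fun a => klFun_nonneg a.coe_nonneg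
  rw [e2, ← ENNReal.ofReal_inv_of_pos two_pos, ← ENNReal.ofReal_mul zero_le_two,
    ← ENNReal.ofReal_mul (by norm_num), ← ENNReal.ofReal_add (mul_nonneg zero_le_two (hn _)) (by positivity),
    ← ENNReal.ofReal_add (hn _) (hn _)]
  refine ENNReal.ofReal_le_ofReal ?_
  push_cast
  linarith

/-- The free energy has a minimizer as soon as the interaction is convex on bounded densities. -/
theorem exists_freeEnergy_minimizer [IsProbabilityMeasure π] (hk : Measurable k)
    (hkint : ∫⁻ p, k p ∂(π.prod π) ≠ ⊤)
    (hconv : ∀ (M : ℝ≥0) (f h : X → ℝ≥0), IsProbDensity π f → IsProbDensity π h →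
      (∀ x, f x ≤ M) → (∀ x, h x ≤ M) →
      interactionEnergy k π f h + interactionEnergy k π h f ≤
        interactionEnergy k π f f + interactionEnergy k π h h) :
    ∃ f, IsProbDensity π f ∧ ∀ h, IsProbDensity π h → freeEnergy k π f ≤ freeEnergy k π h := by
  obtain ⟨I, hI⟩ : ∃ I : ℝ≥0, (⨅ f : {f : X → ℝ≥0 // IsProbDensity π f}, freeEnergy k π f) = I := by
    refine ⟨_, (ENNReal.coe_toNNReal (ne_top_of_le_ne_top hkint ?_)).symm⟩
    rw [← freeEnergy_one (π := π)]
    exact iInf_le_of_le ⟨_, isProbDensity_one⟩ le_rfl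
  have hIle : ∀ h, IsProbDensity π h → I ≤ freeEnergy k π h := fun h hh => by
    rw [← hI]; exact iInf_le_of_le ⟨h, hh⟩ le_rfl
  -- Convexity is only available for bounded densities, so each near-minimizer is truncated, here
  -- with the same kernel and zero error.
  have hseq : ∀ n : ℕ, ∃ f : X → ℝ≥0, IsProbDensity π f ∧ (∃ M, ∀ x, f x ≤ M) ∧
      freeEnergy k π f ≤ I + ((1 / (n + 1) : ℝ≥0) : ℝ≥0∞) := fun n => by
    set ε : ℝ≥0 := 1 / (n + 1) / 2 with hε
    have hε0 : 0 < ε := by positivity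
    obtain ⟨M, τ, hτ, H⟩ := exists_bounded_density (π := π) (I + ε) ε hε0
    have hlt : (⨅ f : {f : X → ℝ≥0 // IsProbDensity π f}, freeEnergy k π f) < I + ε := by
      rw [hI]; exact ENNReal.lt_add_right (by simp) (by simpa using hε0.ne')
    obtain ⟨⟨f, hf⟩, hflt⟩ := iInf_lt_iff.1 hlt
    obtain ⟨ν, hν, hνM, hle⟩ := H k k 0 hk (by simp) (by simp) f hf (by exact_mod_cast hflt.le)
    refine ⟨ν, hν, ⟨M, hνM⟩, hle.trans ?_⟩
    calc freeEnergy k π f + ε ≤ I + ε + ε := by gcongr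
      _ = I + ((ε + ε : ℝ≥0) : ℝ≥0∞) := by push_cast; ring
      _ = _ := by rw [hε, add_halves]
  choose F hF hFM hFI using hseq
  choose B hB using hFM
  -- The parallelogram argument: the midpoint has free energy at least `I`, while convexity puts it
  -- below the average of the two energies by a multiple of the squared Hellinger distance.
  have hD : ∀ n m N : ℕ, N ≤ n → N ≤ m →
      ∫⁻ x, ENNReal.ofReal ((√(F n x : ℝ) - √(F m x : ℝ)) ^ 2) ∂π ≤
        ((4 / (N + 1) : ℝ≥0) : ℝ≥0∞) := fun n m N hn hm => by
    set D := ∫⁻ x, ENNReal.ofReal ((√(F n x : ℝ) - √(F m x : ℝ)) ^ 2) ∂π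
    have h1 := interactionEnergy_midpoint (π := π) hk (hF n).measurable (hF m).measurable
    have h2 := hconv (max (B n) (B m)) _ _ (hF n) (hF m)
      (fun x => (hB n x).trans (le_max_left _ _)) (fun x => (hB m x).trans (le_max_right _ _))
    have h3 := relEntropy_midpoint_add_le (π := π) (hF n).measurable (hF m).measurable
    have h4 := hIle _ ((hF n).midpoint (hF m))
    have hb : ∀ j, N ≤ j → freeEnergy k π (F j) ≤ I + ((1 / (N + 1) : ℝ≥0) : ℝ≥0∞) := fun j hj => by
      refine (hFI j).trans ?_
      gcongr
    have h5 : 2 * (2 * (I : ℝ≥0∞)) + D ≤ 2 * (2 * I) + ((4 / (N + 1) : ℝ≥0) : ℝ≥0∞) := by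
      set E := interactionEnergy k π (fun x => (F n x + F m x) / 2) (fun x => (F n x + F m x) / 2)
      set S := relEntropy π (fun x => (F n x + F m x) / 2)
      calc 2 * (2 * (I : ℝ≥0∞)) + D ≤ 2 * (2 * (E + S)) + (2 * 2⁻¹) * D := by
            rw [ENNReal.mul_inv_cancel two_ne_zero (by simp), one_mul]; gcongr; exact h4
        _ = 4 * E + 2 * (2 * S + 2⁻¹ * D) := by ring
        _ ≤ (interactionEnergy k π (F n) (F n) + interactionEnergy k π (F m) (F m) +
              (interactionEnergy k π (F n) (F n) + interactionEnergy k π (F m) (F m))) +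
              2 * (relEntropy π (F n) + relEntropy π (F m)) := by rw [h1]; gcongr
        _ = 2 * (freeEnergy k π (F n) + freeEnergy k π (F m)) := by simp only [freeEnergy]; ring
        _ ≤ 2 * (I + ((1 / (N + 1) : ℝ≥0) : ℝ≥0∞) + (I + ((1 / (N + 1) : ℝ≥0) : ℝ≥0∞))) := by
            gcongr
            · exact hb n hn
            · exact hb m hm
        _ = 2 * (2 * I) + ((2 * (2 * (1 / (N + 1))) : ℝ≥0) : ℝ≥0∞) := by push_cast; ring
        _ = _ := by congr 2; ring
    exact (ENNReal.add_le_add_iff_left (by finiteness)).1 h5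
  -- The square roots are unit vectors of `L²(π)`, and `hD` makes them Cauchy. Strong convergence
  -- preserves the norm, so the squared limit is again a probability density and no mass escapes.
  have hmeas : ∀ n, Measurable fun x => √(F n x : ℝ) := fun n =>
    (hF n).measurable.coe_nnreal_real.sqrt
  have hnorm : ∀ n, eLpNorm (fun x => √(F n x : ℝ)) 2 π ^ 2 = 1 := fun n => by
    rw [eLpNorm_two_sq, ← (hF n).lintegral_eq_one]
    exact lintegral_congr fun x => ofReal_sqrt_sq _
  have hmem : ∀ n, MemLp (fun x => √(F n x : ℝ)) 2 π := fun n => by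
    refine ⟨(hmeas n).aestronglyMeasurable, ?_⟩
    by_contra hcon
    rw [not_lt, top_le_iff] at hcon
    have := hnorm n
    simp [hcon] at this
  set u : ℕ → Lp ℝ 2 π := fun n => (hmem n).toLp _ with hu
  have hcauchy : CauchySeq u := by
    refine cauchySeq_of_le_tendsto_0 (fun N : ℕ => √(4 / ((N : ℝ) + 1))) (fun n m N hn hm => ?_) ?_
    · refine Real.le_sqrt_of_sq_le ?_
      rw [Lp.dist_def, ← ENNReal.toReal_pow]
      have he : eLpNorm (⇑(u n) - ⇑(u m)) 2 π =
          eLpNorm (fun x => √(F n x : ℝ) - √(F m x : ℝ)) 2 π := by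
        refine eLpNorm_congr_ae ?_
        filter_upwards [(hmem n).coeFn_toLp, (hmem m).coeFn_toLp] with x hx hx'
        simp [hu, hx, hx']
      rw [he, eLpNorm_two_sq]
      have := ENNReal.toReal_mono ENNReal.coe_ne_top (hD n m N hn hm)
      rw [ENNReal.coe_toReal] at this
      simpa using this
    · have h1 : Tendsto (fun N : ℕ => 4 / ((N : ℝ) + 1)) atTop (𝓝 0) := by
        simpa [div_eq_mul_inv] using
          (tendsto_one_div_add_atTop_nhds_zero_nat (𝕜 := ℝ)).const_mul (4 : ℝ)
      simpa using h1.sqrt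
  obtain ⟨U, hU⟩ := cauchySeq_tendsto_of_complete hcauchy
  obtain ⟨φ, hφ, hae⟩ := (tendstoInMeasure_of_tendsto_Lp hU).exists_seq_tendsto_ae
  have hUm : Measurable U := (Lp.stronglyMeasurable U).measurable
  set f : X → ℝ≥0 := fun x => Real.toNNReal (U x ^ 2) with hf
  have hfm : Measurable f := (hUm.pow_const 2).real_toNNReal
  have hlim : ∀ᵐ x ∂π, Tendsto (fun n => F (φ n) x) atTop (𝓝 (f x)) := by
    have hall : ∀ᵐ x ∂π, ∀ n, u n x = √(F n x : ℝ) :=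
      ae_all_iff.2 fun n => (hmem n).coeFn_toLp
    filter_upwards [hae, hall] with x hx hx'
    have h1 := (continuous_real_toNNReal.tendsto _).comp (hx.pow 2)
    refine h1.congr fun n => ?_
    simp only [Function.comp, hx', Real.sq_sqrt (F (φ n) x).coe_nonneg, Real.toNNReal_coe]
  have hf1 : ∫⁻ x, (f x : ℝ≥0∞) ∂π = 1 := by
    have h1 : ∫⁻ x, (f x : ℝ≥0∞) ∂π = eLpNorm U 2 π ^ 2 := by rw [eLpNorm_two_sq]; rfl
    have h2 : Tendsto (fun n => ‖u n‖) atTop (𝓝 ‖U‖) := hU.norm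
    have h3 : ∀ n, ‖u n‖ = 1 := fun n => by
      rw [hu, Lp.norm_toLp]
      have := hnorm n
      have h4 := congrArg ENNReal.toReal this
      rw [ENNReal.toReal_pow, ENNReal.toReal_one] at h4
      exact (pow_eq_one_iff_of_nonneg ENNReal.toReal_nonneg two_ne_zero).1 h4
    simp_rw [h3] at h2
    have h5 : ‖U‖ = 1 := (tendsto_nhds_unique h2 tendsto_const_nhds)
    rw [Lp.norm_def] at h5
    rw [h1, ← ENNReal.toReal_eq_one_iff, ENNReal.toReal_pow, h5, one_pow]
  refine ⟨f, ⟨hfm, hf1⟩, fun h hh => le_trans ?_ (hIle h hh)⟩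
  refine (freeEnergy_le_liminf hk hkint (fun n => (hF (φ n)).measurable) hfm hlim).trans ?_
  have hto : Tendsto (fun n : ℕ => (I : ℝ≥0∞) + ((1 / ((φ n : ℕ) + 1) : ℝ≥0) : ℝ≥0∞)) atTop
      (𝓝 (I + 0)) := by
    refine tendsto_const_nhds.add ?_
    have h1 : Tendsto (fun n : ℕ => (1 / ((n : ℝ≥0) + 1))) atTop (𝓝 0) :=
      tendsto_one_div_add_atTop_nhds_zero_nat
    rw [← ENNReal.coe_zero]
    exact ENNReal.tendsto_coe.2 (h1.comp hφ.tendsto_atTop)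
  rw [add_zero] at hto
  rw [← hto.liminf_eq]
  exact liminf_le_liminf (Eventually.of_forall fun n => hFI (φ n))

end Minimizer

/-! ### Finite product measures -/

section Product

variable {X : Type*} [MeasurableSpace X]

lemma lintegral_pi_prod (μ : Measure X) [SigmaFinite μ] :
    ∀ (N : ℕ) (f : Fin N → X → ℝ≥0∞), (∀ i, Measurable (f i)) →
      ∫⁻ x, ∏ i, f i (x i) ∂(Measure.pi fun _ : Fin N => μ) = ∏ i, ∫⁻ y, f i y ∂μ
  | 0, f, _ => by simp
  | N + 1, f, hf => by
    rw [← (measurePreserving_piFinSuccAbove (fun _ : Fin (N + 1) => μ) 0).symm.lintegral_comp_emb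
      (MeasurableEquiv.measurableEmbedding _)]
    have h : ∀ p : X × (Fin N → X), ∏ i, f i (((MeasurableEquiv.piFinSuccAbove
        (fun _ : Fin (N + 1) => X) 0).symm p) i) = f 0 p.1 * ∏ i, f (Fin.succ i) (p.2 i) :=
      fun p => by
        rw [Fin.prod_univ_succ]
        simp [MeasurableEquiv.piFinSuccAbove]
    simp_rw [h]
    rw [lintegral_prod_mul (g := fun y : Fin N → X => ∏ i, f (Fin.succ i) (y i))
      (hf 0).aemeasurable (Finset.measurable_prod _ fun i _ =>
        (hf i.succ).comp (measurable_pi_apply i)).aemeasurable,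
      lintegral_pi_prod μ N (fun i => f i.succ) fun i => hf _, Fin.prod_univ_succ]

lemma measurable_pi_prod {N : ℕ} {w : X → ℝ≥0∞} (hw : Measurable w) :
    Measurable fun x : Fin N → X => ∏ i, w (x i) :=
  Finset.measurable_prod _ fun i _ => hw.comp (measurable_pi_apply i)

lemma pi_withDensity (μ : Measure X) [SigmaFinite μ] {w : X → ℝ≥0∞} (hw : Measurable w)
    [SigmaFinite (μ.withDensity w)] (N : ℕ) :
    Measure.pi (fun _ : Fin N => μ.withDensity w) =
      (Measure.pi fun _ : Fin N => μ).withDensity fun x => ∏ i, w (x i) := by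
  refine Measure.pi_eq (μ := fun _ : Fin N => μ.withDensity w) fun s hs => ?_
  rw [withDensity_apply _ (MeasurableSet.univ_pi hs), ← lintegral_indicator (MeasurableSet.univ_pi hs)]
  have h : ∀ x : Fin N → X, (Set.univ.pi s).indicator (fun x => ∏ i, w (x i)) x =
      ∏ i, (s i).indicator w (x i) := fun x => by
    by_cases hx : x ∈ Set.univ.pi s
    · rw [Set.indicator_of_mem hx]
      exact Finset.prod_congr rfl fun i _ => (Set.indicator_of_mem (hx i (Set.mem_univ i)) _).symm
    · rw [Set.indicator_of_notMem hx]
      simp only [Set.mem_pi, Set.mem_univ, true_implies, not_forall] at hx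
      obtain ⟨i, hi⟩ := hx
      exact (Finset.prod_eq_zero (Finset.mem_univ i) (Set.indicator_of_notMem hi _)).symm
  simp_rw [h]
  rw [lintegral_pi_prod μ N (fun i => (s i).indicator w) fun i => hw.indicator (hs i)]
  exact Finset.prod_congr rfl fun i _ => by
    rw [lintegral_indicator (hs i), withDensity_apply _ (hs i)]

lemma map_pair_pi (ν : Measure X) [IsProbabilityMeasure ν] {N : ℕ} {i j : Fin N} (hij : i ≠ j) :
    MeasurePreserving (fun x : Fin N → X => (x i, x j)) (Measure.pi fun _ : Fin N => ν)
      (ν.prod ν) := by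
  refine ⟨(measurable_pi_apply i).prodMk (measurable_pi_apply j), ?_⟩
  have h := ProbabilityTheory.iIndepFun_pi (μ := fun _ : Fin N => ν) (X := fun _ x => x)
    fun _ => aemeasurable_id
  have h2 := (ProbabilityTheory.indepFun_iff_map_prod_eq_prod_map_map
    (measurable_pi_apply i).aemeasurable (measurable_pi_apply j).aemeasurable).1 (h.indepFun hij)
  rw [h2, (measurePreserving_eval (fun _ : Fin N => ν) i).map_eq,
    (measurePreserving_eval (fun _ : Fin N => ν) j).map_eq]

lemma ofReal_integral_le_lintegral_ofReal {μ : Measure X} {h : X → ℝ} (hh : Integrable h μ) :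
    ENNReal.ofReal (∫ x, h x ∂μ) ≤ ∫⁻ x, ENNReal.ofReal (h x) ∂μ := by
  rw [integral_eq_lintegral_pos_part_sub_lintegral_neg_part hh]
  refine (ENNReal.ofReal_le_ofReal (sub_le_self _ ENNReal.toReal_nonneg)).trans ?_
  exact ENNReal.ofReal_toReal_le

end Product

/-! ### Partition function and the variational lower bound -/

section Gibbs

/-- The Boltzmann factor `exp (-u)`, with `exp (-∞) = 0`. -/
noncomputable def boltzmann (u : ℝ≥0∞) : ℝ≥0∞ := EReal.exp (-(u : EReal))

lemma boltzmann_antitone : Antitone boltzmann := fun _ _ h =>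
  EReal.exp_monotone (EReal.neg_le_neg_iff.2 (EReal.coe_ennreal_le_coe_ennreal_iff.2 h))

lemma measurable_boltzmann : Measurable boltzmann := boltzmann_antitone.measurable

lemma boltzmann_of_ne_top {u : ℝ≥0∞} (hu : u ≠ ⊤) :
    boltzmann u = ENNReal.ofReal (Real.exp (-u.toReal)) := by
  lift u to ℝ≥0 using hu
  rw [boltzmann, ENNReal.coe_toReal, ← EReal.exp_coe]
  rfl

variable {X : Type*} [MeasurableSpace X]

/-- The interaction energy of `N` points, `N⁻¹ ∑_{i ≠ j} k (x i, x j)`. -/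
noncomputable def pairEnergy (k : X × X → ℝ≥0∞) (N : ℕ) (x : Fin N → X) : ℝ≥0∞ :=
  (N : ℝ≥0∞)⁻¹ * ∑ p ∈ (Finset.univ : Finset (Fin N)).offDiag, k (x p.1, x p.2)

/-- The partition function of `N` points with a priori distribution `π`. -/
noncomputable def gibbsPartition (k : X × X → ℝ≥0∞) (π : Measure X) (N : ℕ) : ℝ≥0∞ :=
  ∫⁻ x, boltzmann (pairEnergy k N x) ∂(Measure.pi fun _ : Fin N => π)

variable {π : Measure X} {f : X → ℝ≥0} {k : X × X → ℝ≥0∞}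

lemma measurable_pairEnergy (hk : Measurable k) (N : ℕ) : Measurable (pairEnergy k N) := by
  refine (Finset.measurable_sum _ fun p _ => ?_).const_mul _
  exact hk.comp ((measurable_pi_apply _).prodMk (measurable_pi_apply _))

lemma lintegral_prod_withDensity [SigmaFinite π] {h : X → ℝ≥0} (hk : Measurable k)
    (hf : Measurable f) (hh : Measurable h) [SFinite (π.withDensity fun x => (f x : ℝ≥0∞))]
    [SFinite (π.withDensity fun x => (h x : ℝ≥0∞))] :
    ∫⁻ p, k p ∂((π.withDensity fun x => (f x : ℝ≥0∞)).prod
      (π.withDensity fun x => (h x : ℝ≥0∞))) = interactionEnergy k π f h := by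
  rw [prod_withDensity hf.coe_nnreal_ennreal hh.coe_nnreal_ennreal,
    lintegral_withDensity_eq_lintegral_mul _ (measurable_density_prod hf hh) hk, interactionEnergy]
  exact lintegral_congr fun p => mul_comm _ _

lemma IsProbDensity.isProbabilityMeasure (hf : IsProbDensity π f) :
    IsProbabilityMeasure (π.withDensity fun x => (f x : ℝ≥0∞)) :=
  ⟨by rw [withDensity_apply _ MeasurableSet.univ, Measure.restrict_univ, hf.lintegral_eq_one]⟩

/-- Each of the `N (N - 1)` ordered pairs has law `ν ⊗ ν`, and the normalization leaves `N - 1 ≤ N`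
copies of the interaction. -/
lemma lintegral_pairEnergy_le [SigmaFinite π] (hk : Measurable k) (hf : IsProbDensity π f) {N : ℕ}
    (hN : N ≠ 0) :
    ∫⁻ x, pairEnergy k N x ∂(Measure.pi fun _ : Fin N => π.withDensity fun x => (f x : ℝ≥0∞)) ≤
      N * interactionEnergy k π f f := by
  have := hf.isProbabilityMeasure
  have hm : ∀ p : Fin N × Fin N, Measurable fun x : Fin N → X => k (x p.1, x p.2) := fun p =>
    hk.comp ((measurable_pi_apply _).prodMk (measurable_pi_apply _))
  simp only [pairEnergy]
  rw [lintegral_const_mul _ (Finset.measurable_sum _ fun p _ => hm p),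
    lintegral_finsetSum _ fun p _ => hm p]
  have h1 : ∀ p ∈ (Finset.univ : Finset (Fin N)).offDiag,
      ∫⁻ x, k (x p.1, x p.2) ∂(Measure.pi fun _ : Fin N => π.withDensity fun x => (f x : ℝ≥0∞)) =
        interactionEnergy k π f f := fun p hp => by
    rw [← lintegral_prod_withDensity hk hf.measurable hf.measurable]
    exact (map_pair_pi _ (Finset.mem_offDiag.1 hp).2.2).lintegral_comp hk
  rw [Finset.sum_congr rfl h1, Finset.sum_const, Finset.offDiag_card, Finset.card_univ,
    Fintype.card_fin, nsmul_eq_mul]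
  have hN' : (N : ℝ≥0∞) ≠ 0 := by simpa using hN
  calc (N : ℝ≥0∞)⁻¹ * (((N * N - N : ℕ) : ℝ≥0∞) * interactionEnergy k π f f)
      ≤ (N : ℝ≥0∞)⁻¹ * (((N * N : ℕ) : ℝ≥0∞) * interactionEnergy k π f f) := by
        gcongr; exact Nat.sub_le _ _
    _ = ((N : ℝ≥0∞)⁻¹ * N) * (N * interactionEnergy k π f f) := by push_cast; ring
    _ = _ := by rw [ENNReal.inv_mul_cancel hN' (by simp), one_mul]

/-- `klFun f` differs from `f log f` by `1 - f`, whose integral vanishes, so `relEntropy` is the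
classical relative entropy. -/
lemma integrable_log_density [IsProbabilityMeasure π] (hf : IsProbDensity π f)
    (hfin : relEntropy π f ≠ ⊤) :
    Integrable (fun x => Real.log (f x)) (π.withDensity fun x => (f x : ℝ≥0∞)) ∧
      ∫ x, Real.log (f x) ∂(π.withDensity fun x => (f x : ℝ≥0∞)) = (relEntropy π f).toReal := by
  have hfi : Integrable (fun x => (f x : ℝ)) π := by
    refine ⟨hf.measurable.coe_nnreal_real.aestronglyMeasurable, ?_⟩
    rw [hasFiniteIntegral_iff_ofReal (ae_of_all _ fun x => (f x).coe_nonneg)]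
    simp [hf.lintegral_eq_one]
  have hki : Integrable (fun x => klFun (f x)) π := by
    refine ⟨(measurable_klFun.comp hf.measurable.coe_nnreal_real).aestronglyMeasurable, ?_⟩
    rw [hasFiniteIntegral_iff_ofReal (ae_of_all _ fun x => klFun_nonneg (f x).coe_nonneg)]
    exact hfin.lt_top
  have hint : ∫ x, (f x : ℝ) ∂π = 1 := by
    rw [integral_eq_lintegral_of_nonneg_ae (ae_of_all _ fun x => (f x).coe_nonneg)
      hfi.aestronglyMeasurable]
    simp [hf.lintegral_eq_one]
  have hkint : ∫ x, klFun (f x) ∂π = (relEntropy π f).toReal :=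
    integral_eq_lintegral_of_nonneg_ae (ae_of_all _ fun x => klFun_nonneg (f x).coe_nonneg)
      hki.aestronglyMeasurable
  have he : ∀ x, f x • Real.log (f x) = klFun (f x) - 1 + f x := fun x => by
    rw [klFun_apply, NNReal.smul_def, smul_eq_mul]; ring
  constructor
  · rw [integrable_withDensity_iff_integrable_smul hf.measurable]
    simp_rw [he]
    exact (hki.sub (integrable_const 1)).add hfi
  · rw [integral_withDensity_eq_integral_smul hf.measurable]
    simp_rw [he]
    rw [integral_add (f := fun x => klFun (f x) - 1) (hki.sub (integrable_const 1)) hfi, integral_sub hki (integrable_const 1),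
      hkint, hint]
    simp

/-- The Gibbs variational lower bound, tested against product measures. -/
theorem boltzmann_le_gibbsPartition [IsProbabilityMeasure π] (hk : Measurable k)
    (hf : IsProbDensity π f) (hfin : freeEnergy k π f ≠ ⊤) {N : ℕ} (hN : N ≠ 0) :
    boltzmann (N * freeEnergy k π f) ≤ gibbsPartition k π N := by
  have := hf.isProbabilityMeasure
  have hfin' := hfin
  rw [freeEnergy, ENNReal.add_ne_top] at hfin'
  set ν := π.withDensity fun x => (f x : ℝ≥0∞) with hν
  set P := Measure.pi fun _ : Fin N => ν with hP
  set c : ℝ := N * (freeEnergy k π f).toReal with hc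
  obtain ⟨hlogi, hlog⟩ := integrable_log_density hf hfin'.2
  have hUle := lintegral_pairEnergy_le hk hf hN
  rw [← hν, ← hP] at hUle
  have hUfin : ∫⁻ x, pairEnergy k N x ∂P ≠ ⊤ :=
    ne_top_of_le_ne_top (ENNReal.mul_ne_top (by simp) hfin'.1) hUle
  have hUm := measurable_pairEnergy hk N
  have hUi : Integrable (fun x => (pairEnergy k N x).toReal) P :=
    integrable_toReal_of_lintegral_ne_top hUm.aemeasurable hUfin
  have hUint : ∫ x, (pairEnergy k N x).toReal ∂P ≤ N * (interactionEnergy k π f f).toReal := by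
    rw [integral_toReal hUm.aemeasurable (ae_lt_top hUm hUfin)]
    simpa using ENNReal.toReal_mono (ENNReal.mul_ne_top (by simp) hfin'.1) hUle
  have hLi : ∀ i : Fin N, Integrable (fun x : Fin N → X => Real.log (f (x i))) P := fun i =>
    (measurePreserving_eval (fun _ : Fin N => ν) i).integrable_comp_of_integrable hlogi
  have hLint : ∫ x, ∑ i, Real.log (f (x i)) ∂P = N * (relEntropy π f).toReal := by
    rw [integral_finsetSum _ fun i _ => hLi i]
    have : ∀ i : Fin N, ∫ x, Real.log (f (x i)) ∂P = (relEntropy π f).toReal := fun i => by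
      rw [← hlog, ← hν, ← (measurePreserving_eval (fun _ : Fin N => ν) i).map_eq,
        integral_map (measurable_pi_apply i).aemeasurable]
      exact (Real.measurable_log.comp hf.measurable.coe_nnreal_real).aestronglyMeasurable
    simp [this]
  -- The tangent to `exp (-t)` at `t = c`, evaluated at energy plus log density, stands in for
  -- Jensen's inequality. Since that quantity has mean at most `c`, the tangent has mean at least
  -- `exp (-c)`.
  set h : (Fin N → X) → ℝ := fun x =>
    Real.exp (-c) * ((1 + c) - ((pairEnergy k N x).toReal + ∑ i, Real.log (f (x i)))) with hh
  have hhi0 : Integrable (fun x => (pairEnergy k N x).toReal + ∑ i, Real.log (f (x i))) P :=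
    hUi.add (integrable_finsetSum _ fun i _ => hLi i)
  have hhi : Integrable h P := ((integrable_const _).sub hhi0).const_mul _
  have hhint : Real.exp (-c) ≤ ∫ x, h x ∂P := by
    rw [hh, integral_const_mul, integral_sub (integrable_const _) hhi0,
      integral_add hUi (integrable_finsetSum _ fun i _ => hLi i), hLint]
    simp only [integral_const, probReal_univ, one_smul]
    refine le_mul_of_one_le_right (Real.exp_pos _).le ?_
    have : c = N * (interactionEnergy k π f f).toReal + N * (relEntropy π f).toReal := by
      rw [hc, freeEnergy, ENNReal.toReal_add hfin'.1 hfin'.2, mul_add]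
    linarith
  have hF : Measurable fun x : Fin N → X => ∏ i, (f (x i) : ℝ≥0∞) :=
    measurable_pi_prod hf.measurable.coe_nnreal_ennreal
  have hfpos : ∀ᵐ x ∂P, ∀ i, f (x i) ≠ 0 := by
    refine ae_all_iff.2 fun i => ?_
    have h0 : ∀ᵐ y ∂ν, f y ≠ 0 := by
      rw [hν, ae_withDensity_iff hf.measurable.coe_nnreal_ennreal]
      exact ae_of_all _ fun y hy => by simpa using hy
    exact (measurePreserving_eval (fun _ : Fin N => ν) i).quasiMeasurePreserving.ae h0
  calc boltzmann (N * freeEnergy k π f) = ENNReal.ofReal (Real.exp (-c)) := by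
        rw [boltzmann_of_ne_top (ENNReal.mul_ne_top (by simp) hfin)]
        simp [hc]
    _ ≤ ENNReal.ofReal (∫ x, h x ∂P) := ENNReal.ofReal_le_ofReal hhint
    _ ≤ ∫⁻ x, ENNReal.ofReal (h x) ∂P := ofReal_integral_le_lintegral_ofReal hhi
    _ ≤ ∫⁻ x, boltzmann (pairEnergy k N x) * (∏ i, (f (x i) : ℝ≥0∞))⁻¹ ∂P := by
        refine lintegral_mono_ae ?_
        filter_upwards [hfpos, ae_lt_top hUm hUfin] with x hx hUx
        have hpos : 0 < ∏ i, (f (x i) : ℝ) := Finset.prod_pos fun i _ =>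
          NNReal.coe_pos.2 (pos_iff_ne_zero.2 (hx i))
        have h1 : ∏ i, (f (x i) : ℝ≥0∞) = ENNReal.ofReal (∏ i, (f (x i) : ℝ)) := by
          rw [ENNReal.ofReal_prod_of_nonneg fun i _ => (f (x i)).coe_nonneg]
          simp
        rw [boltzmann_of_ne_top hUx.ne, h1, ← ENNReal.ofReal_inv_of_pos hpos,
          ← ENNReal.ofReal_mul (Real.exp_pos _).le]
        refine ENNReal.ofReal_le_ofReal ?_
        have h2 : (∏ i, (f (x i) : ℝ))⁻¹ = Real.exp (-∑ i, Real.log (f (x i))) := by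
          rw [← Real.log_prod fun i _ => by simpa using hx i, Real.exp_neg, Real.exp_log hpos]
        rw [h2, ← Real.exp_add]
        set t := (pairEnergy k N x).toReal + ∑ i, Real.log (f (x i)) with ht
        have h3 : Real.exp (-c) * (1 + c - t) ≤ Real.exp (-c) * Real.exp (c - t) := by
          gcongr
          linarith [Real.add_one_le_exp (c - t)]
        refine h3.trans_eq ?_
        rw [← Real.exp_add]
        congr 1
        rw [ht]; ring
    -- Returning from `P` to the product of `π` multiplies by the density. The product of the
    -- density and its inverse is at most one; only the set where the density vanishes is lost.
    _ ≤ gibbsPartition k π N := by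
        rw [hP, hν, pi_withDensity π hf.measurable.coe_nnreal_ennreal N,
          lintegral_withDensity_eq_lintegral_mul _ hF
            (g := fun x => boltzmann (pairEnergy k N x) * (∏ i, (f (x i) : ℝ≥0∞))⁻¹)
            ((measurable_boltzmann.comp hUm).mul hF.inv), gibbsPartition]
        refine lintegral_mono fun x => ?_
        simp only [Pi.mul_apply]
        rw [mul_left_comm]
        exact mul_le_of_le_one_right' (by rw [mul_comm]; exact ENNReal.inv_mul_le_one _)

end Gibbs

/-! ### Step kernels and the method of types -/

section Types

lemma boltzmann_zero : boltzmann 0 = 1 := by simp [boltzmann]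

lemma boltzmann_add (u v : ℝ≥0∞) : boltzmann (u + v) = boltzmann u * boltzmann v := by
  rcases eq_or_ne u ⊤ with rfl | hu
  · simp [boltzmann]
  rcases eq_or_ne v ⊤ with rfl | hv
  · simp [boltzmann]
  rw [boltzmann_of_ne_top hu, boltzmann_of_ne_top hv, boltzmann_of_ne_top (by finiteness),
    ← ENNReal.ofReal_mul (Real.exp_pos _).le, ← Real.exp_add, ENNReal.toReal_add hu hv, neg_add]

lemma density_mul_weight {ι : Type*} {p w : ι → ℝ≥0} (hpw : ∀ a, w a = 0 → p a = 0) (a : ι) : p a / w a * w a = p a := by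
  rcases eq_or_ne (w a) 0 with h | h
  · rw [hpw a h, h, mul_zero]
  · exact div_mul_cancel₀ _ h

/-- The number of indices at which `z` takes the value `a`. -/
def typeCount {ι : Type*} [DecidableEq ι] {N : ℕ} (z : Fin N → ι) (a : ι) : ℕ := (Finset.univ.filter fun i => z i = a).card

lemma typeCount_le {ι : Type*} [DecidableEq ι] {N : ℕ} (z : Fin N → ι) (a : ι) : typeCount z a ≤ N :=
  (Finset.card_filter_le _ _).trans (by simp)

lemma sum_typeCount_mul {ι : Type*} [Fintype ι] [DecidableEq ι] {R : Type*} [CommSemiring R] {N : ℕ} (z : Fin N → ι) (G : ι → R) :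
    ∑ a, (typeCount z a : R) * G a = ∑ i, G (z i) := by
  simp only [typeCount, Finset.card_filter, Nat.cast_sum, Finset.sum_mul]
  rw [Finset.sum_comm]
  refine Finset.sum_congr rfl fun i _ => ?_
  simp

variable {X ι : Type*} [MeasurableSpace X] [Fintype ι] [MeasurableSpace ι]
  [MeasurableSingletonClass ι] {π : Measure X} {c : X → ι}

lemma lintegral_comp_finite (hc : Measurable c) (F : ι → ℝ≥0∞) :
    ∫⁻ x, F (c x) ∂π = ∑ a, F a * π (c ⁻¹' {a}) := by
  rw [← lintegral_map (measurable_of_finite F) hc, lintegral_fintype]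
  exact Finset.sum_congr rfl fun a _ => by
    rw [Measure.map_apply hc (measurableSet_singleton a)]

lemma lintegral_prod_comp_finite [SFinite π] (hc : Measurable c) (F : ι → ι → ℝ≥0∞) :
    ∫⁻ p, F (c p.1) (c p.2) ∂(π.prod π) =
      ∑ a, ∑ b, F a b * (π (c ⁻¹' {a}) * π (c ⁻¹' {b})) := by
  have hm : Measurable fun p : X × X => F (c p.1) (c p.2) :=
    (measurable_of_finite fun q : ι × ι => F q.1 q.2).comp
      ((hc.comp measurable_fst).prodMk (hc.comp measurable_snd))
  rw [lintegral_prod _ hm.aemeasurable]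
  simp_rw [fun a => lintegral_comp_finite (π := π) hc (F a)]
  rw [lintegral_comp_finite hc fun a => ∑ b, F a b * π (c ⁻¹' {b})]
  refine Finset.sum_congr rfl fun a _ => ?_
  rw [Finset.sum_mul]
  exact Finset.sum_congr rfl fun b _ => by ring

variable {p w : ι → ℝ≥0}

/-- The cell weights `p` are absolutely continuous with respect to `w`, so the convention `0 / 0 =
0` on null cells loses no mass. -/
lemma isProbDensity_comp (hc : Measurable c) (hw : ∀ a, π (c ⁻¹' {a}) = w a) (hp : ∑ a, p a = 1)
    (hpw : ∀ a, w a = 0 → p a = 0) : IsProbDensity π fun x => p (c x) / w (c x) := by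
  refine ⟨(measurable_of_finite fun a => p a / w a).comp hc, ?_⟩
  rw [lintegral_comp_finite hc fun a => ((p a / w a : ℝ≥0) : ℝ≥0∞)]
  simp_rw [hw, ← ENNReal.coe_mul, density_mul_weight hpw]
  exact_mod_cast hp

lemma interactionEnergy_comp [SFinite π] (hc : Measurable c) (hw : ∀ a, π (c ⁻¹' {a}) = w a)
    (hpw : ∀ a, w a = 0 → p a = 0) (S : ι → ι → ℝ≥0∞) :
    interactionEnergy (fun q => S (c q.1) (c q.2)) π (fun x => p (c x) / w (c x))
      (fun x => p (c x) / w (c x)) = ∑ a, ∑ b, S a b * (p a * p b) := by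
  rw [interactionEnergy, lintegral_prod_comp_finite hc
    fun a b => S a b * (((p a / w a : ℝ≥0) : ℝ≥0∞) * ((p b / w b : ℝ≥0) : ℝ≥0∞))]
  refine Finset.sum_congr rfl fun a _ => Finset.sum_congr rfl fun b _ => ?_
  rw [hw, hw]
  conv_rhs => rw [← density_mul_weight hpw a, ← density_mul_weight hpw b]
  push_cast
  ring

lemma relEntropy_comp [IsProbabilityMeasure π] (hc : Measurable c)
    (hw : ∀ a, π (c ⁻¹' {a}) = w a) (hp : ∑ a, p a = 1) (hpw : ∀ a, w a = 0 → p a = 0) :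
    relEntropy π (fun x => p (c x) / w (c x)) ≠ ⊤ ∧
      (relEntropy π fun x => p (c x) / w (c x)).toReal =
        ∑ a, (p a : ℝ) * Real.log (p a / w a : ℝ≥0) := by
  have h1 : relEntropy π (fun x => p (c x) / w (c x)) =
      ENNReal.ofReal (∑ a, klFun (p a / w a : ℝ≥0) * w a) := by
    rw [relEntropy, lintegral_comp_finite hc fun a => ENNReal.ofReal (klFun (p a / w a : ℝ≥0)),
      ENNReal.ofReal_sum_of_nonneg fun a _ =>
        mul_nonneg (klFun_nonneg (NNReal.coe_nonneg _)) (NNReal.coe_nonneg _)]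
    refine Finset.sum_congr rfl fun a _ => ?_
    rw [hw, ENNReal.ofReal_mul (klFun_nonneg (NNReal.coe_nonneg _)), ENNReal.ofReal_coe_nnreal]
  have hw1 : ∑ a, w a = 1 := by
    have := lintegral_comp_finite (π := π) hc fun _ => 1
    simp only [hw, lintegral_const, measure_univ, one_mul] at this
    exact_mod_cast this.symm
  refine ⟨by rw [h1]; exact ENNReal.ofReal_ne_top, ?_⟩
  rw [h1, ENNReal.toReal_ofReal (Finset.sum_nonneg fun a _ =>
    mul_nonneg (klFun_nonneg (NNReal.coe_nonneg _)) (NNReal.coe_nonneg _))]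
  have h2 : ∀ a, klFun (p a / w a : ℝ≥0) * w a =
      p a * Real.log (p a / w a : ℝ≥0) + w a - p a := fun a => by
    have h3 : ((p a / w a : ℝ≥0) : ℝ) * w a = p a := by
      exact_mod_cast congrArg NNReal.toReal (density_mul_weight hpw a)
    rw [klFun_apply]
    conv_rhs => rw [← h3]
    conv_rhs => rw [h3]
    linear_combination (Real.log (p a / w a : ℝ≥0) - 1) * h3
  simp_rw [h2]
  rw [Finset.sum_sub_distrib, Finset.sum_add_distrib]
  have e1 : ∑ a, (w a : ℝ) = 1 := by exact_mod_cast congrArg NNReal.toReal hw1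
  have e2 : ∑ a, (p a : ℝ) = 1 := by exact_mod_cast congrArg NNReal.toReal hp
  rw [e1, e2, add_sub_cancel_right]

variable [DecidableEq ι]

/-- The method of types: the Boltzmann factor of a step kernel is controlled by the product
densities of the empirical types. -/
lemma boltzmann_pairEnergy_le [IsProbabilityMeasure π] (hc : Measurable c)
    (hw : ∀ a, π (c ⁻¹' {a}) = w a) {S : ι → ι → ℝ≥0∞} {B : ℝ≥0} (hSB : ∀ a b, S a b ≤ B)
    {I : ℝ≥0∞} (hI : ∀ f, IsProbDensity π f →
      I ≤ freeEnergy (fun q => S (c q.1) (c q.2)) π f) {N : ℕ} (hN : N ≠ 0) (x : Fin N → X)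
    (hx : ∀ i, w (c (x i)) ≠ 0) :
    IsProbDensity π (fun y => (typeCount (c ∘ x) (c y) / N : ℝ≥0) / w (c y)) ∧
    boltzmann (pairEnergy (fun q => S (c q.1) (c q.2)) N x) * boltzmann B ≤
      boltzmann (N * I) *
        ∏ i, (((typeCount (c ∘ x) (c (x i)) / N : ℝ≥0) / w (c (x i)) : ℝ≥0) : ℝ≥0∞) := by
  set p : ι → ℝ≥0 := fun a => typeCount (c ∘ x) a / N with hp
  have hN0 : (N : ℝ≥0) ≠ 0 := by simpa using hN
  have hpsum : ∑ a, p a = 1 := by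
    have := sum_typeCount_mul (c ∘ x) fun _ => (1 : ℝ≥0)
    simp only [mul_one, Finset.sum_const, Finset.card_univ, Fintype.card_fin, nsmul_eq_mul] at this
    simp only [hp]
    rw [← Finset.sum_div, this, div_self hN0]
  have hpw : ∀ a, w a = 0 → p a = 0 := fun a ha => by
    simp only [hp, typeCount, div_eq_zero_iff, Nat.cast_eq_zero, Finset.card_eq_zero]
    left
    refine Finset.filter_eq_empty_iff.2 fun i _ hi => hx i ?_
    rw [← ha, ← hi]; rfl
  have hd := isProbDensity_comp hc hw hpsum hpw
  refine ⟨hd, ?_⟩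
  have hfree := hI _ hd
  obtain ⟨hne, hrel⟩ := relEntropy_comp hc hw hpsum hpw
  have hinter := interactionEnergy_comp hc hw hpw S
  set f : X → ℝ≥0 := fun y => p (c y) / w (c y) with hf
  have hNp : ∀ a, (N : ℝ≥0) * p a = typeCount (c ∘ x) a := fun a => mul_div_cancel₀ _ hN0
  -- entropy of the empirical type
  have hent : boltzmann (N * relEntropy π f) * ∏ i, (f (x i) : ℝ≥0∞) = 1 := by
    have h1 : (N : ℝ) * (relEntropy π f).toReal = ∑ i, Real.log (f (x i)) := by
      have h0 := sum_typeCount_mul (c ∘ x) fun a => Real.log (p a / w a : ℝ≥0)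
      rw [hrel, Finset.mul_sum]
      refine Eq.trans ?_ h0
      refine Finset.sum_congr rfl fun a _ => ?_
      rw [← mul_assoc]
      congr 1
      exact_mod_cast congrArg NNReal.toReal (hNp a)
    have hpos : ∀ i, 0 < (f (x i) : ℝ) := fun i => by
      refine NNReal.coe_pos.2 (div_pos (div_pos ?_ (pos_iff_ne_zero.2 hN0))
        (pos_iff_ne_zero.2 (hx i)))
      refine Nat.cast_pos.2 (Finset.card_pos.2 ⟨i, ?_⟩)
      simp
    have h2 : ∏ i, (f (x i) : ℝ≥0∞) = ENNReal.ofReal (∏ i, (f (x i) : ℝ)) := by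
      rw [ENNReal.ofReal_prod_of_nonneg fun i _ => (f (x i)).coe_nonneg]
      simp
    rw [boltzmann_of_ne_top (ENNReal.mul_ne_top (by simp) hne), h2,
      ← ENNReal.ofReal_mul (Real.exp_pos _).le, ENNReal.toReal_mul, ENNReal.toReal_natCast, h1,
      ← Real.log_prod fun i _ => (hpos i).ne', Real.exp_neg,
      Real.exp_log (Finset.prod_pos fun i _ => hpos i),
      inv_mul_cancel₀ (Finset.prod_pos fun i _ => hpos i).ne', ENNReal.ofReal_one]
  -- interaction of the empirical type
  have hNE : (N : ℝ≥0∞) ≠ 0 := by simpa using hN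
  have hint : N * interactionEnergy (fun q => S (c q.1) (c q.2)) π f f ≤
      pairEnergy (fun q => S (c q.1) (c q.2)) N x + B := by
    have hpE : ∀ a, (p a : ℝ≥0∞) = (N : ℝ≥0∞)⁻¹ * typeCount (c ∘ x) a := fun a => by
      simp only [hp]
      rw [ENNReal.coe_div hN0, div_eq_mul_inv, mul_comm, ENNReal.coe_natCast, ENNReal.coe_natCast]
    have h1 : (N : ℝ≥0∞) * interactionEnergy (fun q => S (c q.1) (c q.2)) π f f =
        (N : ℝ≥0∞)⁻¹ * ∑ i, ∑ j, S (c (x i)) (c (x j)) := by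
      have h2 : ∑ i, ∑ j, S (c (x i)) (c (x j)) =
          ∑ a, (typeCount (c ∘ x) a : ℝ≥0∞) * ∑ b, (typeCount (c ∘ x) b : ℝ≥0∞) * S a b := by
        simp_rw [fun a => sum_typeCount_mul (c ∘ x) (S a)]
        rw [sum_typeCount_mul (c ∘ x) fun a => ∑ j, S a ((c ∘ x) j)]
        rfl
      rw [hinter, h2, Finset.mul_sum, Finset.mul_sum]
      refine Finset.sum_congr rfl fun a _ => ?_
      rw [Finset.mul_sum, Finset.mul_sum, Finset.mul_sum]
      refine Finset.sum_congr rfl fun b _ => ?_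
      rw [hpE, hpE]
      calc _ = ((N : ℝ≥0∞) * (N : ℝ≥0∞)⁻¹) * ((N : ℝ≥0∞)⁻¹ * ((typeCount (c ∘ x) a : ℝ≥0∞) *
            ((typeCount (c ∘ x) b : ℝ≥0∞) * S a b))) := by ring
        _ = _ := by rw [ENNReal.mul_inv_cancel hNE (by simp), one_mul]
    -- The empirical measure also interacts on the diagonal, which `pairEnergy` omits. Those `N`
    -- terms are worth at most `N⁻¹ · N · B = B`, hence the factor `boltzmann B`.
    have h3 : ∑ i, ∑ j, S (c (x i)) (c (x j)) =
        ∑ q ∈ (Finset.univ : Finset (Fin N)).offDiag, S (c (x q.1)) (c (x q.2)) +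
          ∑ i, S (c (x i)) (c (x i)) := by
      rw [← Finset.sum_product', ← Finset.diag_union_offDiag,
        Finset.sum_union (Finset.disjoint_diag_offDiag _), add_comm, Finset.sum_diag]
    rw [h1, h3, mul_add, pairEnergy]
    gcongr
    calc (N : ℝ≥0∞)⁻¹ * ∑ i, S (c (x i)) (c (x i)) ≤ (N : ℝ≥0∞)⁻¹ * ∑ _i : Fin N, (B : ℝ≥0∞) := by
          gcongr; exact hSB _ _
      _ = ((N : ℝ≥0∞)⁻¹ * N) * B := by simp [mul_assoc]
      _ = B := by rw [ENNReal.inv_mul_cancel hNE (by simp), one_mul]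
  calc boltzmann (pairEnergy (fun q => S (c q.1) (c q.2)) N x) * boltzmann B
      ≤ boltzmann (N * interactionEnergy (fun q => S (c q.1) (c q.2)) π f f) := by
        rw [← boltzmann_add]; exact boltzmann_antitone hint
    _ = boltzmann (N * freeEnergy (fun q => S (c q.1) (c q.2)) π f) *
          ∏ i, (f (x i) : ℝ≥0∞) := by
        rw [freeEnergy, mul_add, boltzmann_add, mul_assoc, hent, mul_one]
    _ ≤ _ := by
        gcongr
        exact boltzmann_antitone (by gcongr)

/-- Upper bound for the partition function of a step kernel. -/
theorem gibbsPartition_step_le [IsProbabilityMeasure π] (hc : Measurable c)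
    {S : ι → ι → ℝ≥0∞} {B : ℝ≥0} (hSB : ∀ a b, S a b ≤ B) {I : ℝ≥0∞}
    (hI : ∀ f, IsProbDensity π f → I ≤ freeEnergy (fun q => S (c q.1) (c q.2)) π f)
    {N : ℕ} (hN : N ≠ 0) :
    gibbsPartition (fun q => S (c q.1) (c q.2)) π N * boltzmann B ≤
      boltzmann (N * I) * ((N + 1 : ℕ) : ℝ≥0∞) ^ Fintype.card ι := by
  classical
  set w : ι → ℝ≥0 := fun a => (π (c ⁻¹' {a})).toNNReal with hwdef
  have hw : ∀ a, π (c ⁻¹' {a}) = w a := fun a => (ENNReal.coe_toNNReal (measure_ne_top _ _)).symm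
  set g : (ι → Fin (N + 1)) → X → ℝ≥0 := fun n y => ((n (c y) : ℕ) / N : ℝ≥0) / w (c y) with hg
  -- Counts take values in `0, …, N`. Only count vectors giving a normalized density are summed, so
  -- each product density integrates to one and the sum is bounded by the number of count vectors.
  set T : Finset (ι → Fin (N + 1)) := Finset.univ.filter fun n => IsProbDensity π (g n) with hT
  have hgm : ∀ n, Measurable fun x : Fin N → X => ∏ i, (g n (x i) : ℝ≥0∞) := fun n =>
    measurable_pi_prod ((measurable_of_finite fun a =>
      ((((n a : ℕ) / N : ℝ≥0) / w a : ℝ≥0) : ℝ≥0∞)).comp hc)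
  -- Almost every configuration avoids the finitely many cells of zero weight.
  have hpos : ∀ᵐ x ∂(Measure.pi fun _ : Fin N => π), ∀ i, w (c (x i)) ≠ 0 := by
    refine ae_all_iff.2 fun i => ?_
    refine (measurePreserving_eval (fun _ : Fin N => π) i).quasiMeasurePreserving.ae
      (p := fun y => w (c y) ≠ 0) ?_
    rw [ae_iff]
    simp only [not_not]
    have : {y | w (c y) = 0} = ⋃ a ∈ {a | w a = 0}, c ⁻¹' {a} := by ext y; simp
    rw [this, measure_biUnion_null_iff (Set.to_countable _)]
    intro a ha
    have h0 : w a = 0 := ha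
    rw [hw, h0, ENNReal.coe_zero]
  calc gibbsPartition (fun q => S (c q.1) (c q.2)) π N * boltzmann B
      ≤ ∫⁻ x, boltzmann (N * I) * ∑ n ∈ T, ∏ i, (g n (x i) : ℝ≥0∞)
          ∂(Measure.pi fun _ : Fin N => π) := by
        rw [gibbsPartition, ← lintegral_mul_const' _ _ (by
          rw [boltzmann_of_ne_top ENNReal.coe_ne_top]; exact ENNReal.ofReal_ne_top)]
        refine lintegral_mono_ae ?_
        filter_upwards [hpos] with x hx
        obtain ⟨h1, h2⟩ := boltzmann_pairEnergy_le hc hw hSB hI hN x hx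
        refine h2.trans ?_
        gcongr
        set n : ι → Fin (N + 1) := fun a =>
          ⟨typeCount (c ∘ x) a, Nat.lt_succ_of_le (typeCount_le _ _)⟩ with hn
        have hnT : n ∈ T := Finset.mem_filter.2 ⟨Finset.mem_univ _, h1⟩
        refine le_trans (le_of_eq (Finset.prod_congr rfl fun i _ => ?_))
          (Finset.single_le_sum (f := fun n => ∏ i, (g n (x i) : ℝ≥0∞))
            (fun _ _ => zero_le) hnT)
        rfl
    _ = boltzmann (N * I) * ∑ n ∈ T, 1 := by
        rw [lintegral_const_mul _ (Finset.measurable_sum _ fun n _ => hgm n),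
          lintegral_finsetSum _ fun n _ => hgm n]
        congr 1
        refine Finset.sum_congr rfl fun n hn => ?_
        have hd : IsProbDensity π (g n) := (Finset.mem_filter.1 hn).2
        rw [lintegral_pi_prod π N (fun _ y => (g n y : ℝ≥0∞)) fun _ =>
          hd.measurable.coe_nnreal_ennreal]
        simp [hd.lintegral_eq_one]
    _ ≤ _ := by
        gcongr
        rw [Finset.sum_const, nsmul_eq_mul, mul_one]
        have : T.card ≤ (N + 1) ^ Fintype.card ι := by
          refine (Finset.card_filter_le _ _).trans ?_
          simp
        exact_mod_cast this

end Types

/-! ### Logarithmic asymptotics of the partition function -/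

section Asymptotics

variable {X : Type*} [MeasurableSpace X] {π : Measure X} {f : X → ℝ≥0} {k : X × X → ℝ≥0∞}

/-- The kernel `k` is an increasing limit in `L¹` of kernels that are constant on the products of
the cells of finite measurable partitions. -/
def IsStepApproximable (k : X × X → ℝ≥0∞) (π : Measure X) : Prop :=
  ∀ τ : ℝ≥0, 0 < τ → ∃ (n : ℕ) (c : X → Fin n → Bool)
    (S : (Fin n → Bool) → (Fin n → Bool) → ℝ≥0∞) (B : ℝ≥0), Measurable c ∧ (∀ a b, S a b ≤ B) ∧
    (∀ p : X × X, S (c p.1) (c p.2) ≤ k p) ∧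
    ∫⁻ p : X × X, (k p - S (c p.1) (c p.2)) ∂(π.prod π) ≤ τ

lemma boltzmann_le_one (u : ℝ≥0∞) : boltzmann u ≤ 1 := by
  rw [← boltzmann_zero]; exact boltzmann_antitone zero_le

lemma gibbsPartition_le_one [IsProbabilityMeasure π] (N : ℕ) : gibbsPartition k π N ≤ 1 := by
  calc gibbsPartition k π N ≤ ∫⁻ _, 1 ∂(Measure.pi fun _ : Fin N => π) :=
        lintegral_mono fun x => boltzmann_le_one _
    _ = 1 := by simp

lemma gibbsPartition_anti {s : X × X → ℝ≥0∞} (h : ∀ p, s p ≤ k p) (N : ℕ) :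
    gibbsPartition k π N ≤ gibbsPartition s π N := by
  refine lintegral_mono fun x => boltzmann_antitone ?_
  unfold pairEnergy
  gcongr
  exact h _

lemma gibbsPartition_pos [IsProbabilityMeasure π] (hk : Measurable k) (hf : IsProbDensity π f)
    (hfin : freeEnergy k π f ≠ ⊤) {N : ℕ} (hN : N ≠ 0) :
    0 < (gibbsPartition k π N).toReal := by
  refine ENNReal.toReal_pos (ne_of_gt ?_)
    ((gibbsPartition_le_one N).trans_lt ENNReal.one_lt_top).ne
  refine lt_of_lt_of_le ?_ (boltzmann_le_gibbsPartition hk hf hfin hN)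
  rw [boltzmann_of_ne_top (ENNReal.mul_ne_top (by simp) hfin)]
  exact ENNReal.ofReal_pos.2 (Real.exp_pos _)

lemma neg_le_log_gibbsPartition [IsProbabilityMeasure π] (hk : Measurable k)
    (hf : IsProbDensity π f) (hfin : freeEnergy k π f ≠ ⊤) {N : ℕ} (hN : N ≠ 0) :
    -(N * (freeEnergy k π f).toReal) ≤ Real.log (gibbsPartition k π N).toReal := by
  rw [Real.le_log_iff_exp_le (gibbsPartition_pos hk hf hfin hN)]
  have h := ENNReal.toReal_mono ((gibbsPartition_le_one N).trans_lt ENNReal.one_lt_top).ne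
    (boltzmann_le_gibbsPartition hk hf hfin hN)
  rw [boltzmann_of_ne_top (ENNReal.mul_ne_top (by simp) hfin),
    ENNReal.toReal_ofReal (Real.exp_pos _).le] at h
  simpa using h

/-- A step kernel below `k` has a larger partition function, to which the method of types applies.
Its minimal free energy is within `η` of that of `k`, because truncated competitors barely notice
the `L¹` difference of the kernels. The constants `B` and `m` come from the step kernel and not from
`N`. -/
lemma log_gibbsPartition_le [IsProbabilityMeasure π] (hk : Measurable k)
    (hstep : IsStepApproximable k π) (hf : IsProbDensity π f) (hfin : freeEnergy k π f ≠ ⊤)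
    (hmin : ∀ h, IsProbDensity π h → freeEnergy k π f ≤ freeEnergy k π h) {η : ℝ≥0}
    (hη : 0 < η) :
    ∃ B : ℝ, ∃ m : ℕ, ∀ N : ℕ, N ≠ 0 → Real.log (gibbsPartition k π N).toReal ≤
      B + m * Real.log (N + 1) - N * ((freeEnergy k π f).toReal - η) := by
  obtain ⟨I, hI⟩ : ∃ I : ℝ≥0, freeEnergy k π f = I := ⟨_, (ENNReal.coe_toNNReal hfin).symm⟩
  rw [hI, ENNReal.coe_toReal]
  -- The order matters: `τ` depends only on `I` and `η`, so the step kernel can be chosen afterwards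
  -- to meet it.
  obtain ⟨M, τ, hτ, H⟩ := exists_bounded_density (π := π) I η hη
  obtain ⟨n, c, S, B, hc, hSB, hSk, hSint⟩ := hstep τ hτ
  have hSm : Measurable fun p : X × X => S (c p.1) (c p.2) :=
    (measurable_of_finite fun q : (Fin n → Bool) × (Fin n → Bool) => S q.1 q.2).comp
      ((hc.comp measurable_fst).prodMk (hc.comp measurable_snd))
  have hlow : ∀ h, IsProbDensity π h →
      ((I - η : ℝ≥0) : ℝ≥0∞) ≤ freeEnergy (fun q => S (c q.1) (c q.2)) π h := fun h hh => by
    -- Truncation needs an a priori bound on the free energy; a density above `I` satisfies the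
    -- claim trivially.
    rcases le_total (freeEnergy (fun q => S (c q.1) (c q.2)) π h) I with hle | hle
    · obtain ⟨ν, hν, -, hνle⟩ := H k (fun q => S (c q.1) (c q.2))
        (fun q => k q - S (c q.1) (c q.2)) hSm
        (ae_of_all _ fun p => le_add_tsub) hSint h hh hle
      rw [ENNReal.coe_sub, tsub_le_iff_right, ← hI]
      exact (hmin ν hν).trans hνle
    · refine le_trans ?_ hle
      exact_mod_cast tsub_le_self
  refine ⟨B, Fintype.card (Fin n → Bool), fun N hN => ?_⟩
  have h1 := gibbsPartition_step_le hc hSB hlow hN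
  have hpos := gibbsPartition_pos hk hf hfin hN
  have hfinS := ((gibbsPartition_le_one (k := fun q => S (c q.1) (c q.2)) (π := π) N).trans_lt
    ENNReal.one_lt_top).ne
  have h2 : (gibbsPartition k π N).toReal * Real.exp (-B) ≤
      Real.exp (-(N * (I - η : ℝ≥0))) * (N + 1 : ℝ) ^ Fintype.card (Fin n → Bool) := by
    have h3 : gibbsPartition k π N * boltzmann B ≤ boltzmann (N * ((I - η : ℝ≥0) : ℝ≥0∞)) *
        ((N + 1 : ℕ) : ℝ≥0∞) ^ Fintype.card (Fin n → Bool) :=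
      le_trans (by gcongr; exact gibbsPartition_anti hSk N) h1
    rw [boltzmann_of_ne_top ENNReal.coe_ne_top,
      boltzmann_of_ne_top (ENNReal.mul_ne_top (by simp) ENNReal.coe_ne_top)] at h3
    have h4 := ENNReal.toReal_mono (ENNReal.mul_ne_top ENNReal.ofReal_ne_top
      (ENNReal.pow_ne_top (ENNReal.natCast_ne_top _))) h3
    rw [ENNReal.toReal_mul, ENNReal.toReal_mul, ENNReal.toReal_ofReal (Real.exp_pos _).le,
      ENNReal.toReal_ofReal (Real.exp_pos _).le, ENNReal.toReal_pow, ENNReal.toReal_natCast,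
      ENNReal.toReal_mul, ENNReal.toReal_natCast, ENNReal.coe_toReal, ENNReal.coe_toReal] at h4
    exact_mod_cast h4
  have hN1 : (0 : ℝ) < N + 1 := by positivity
  have h5 := Real.log_le_log (mul_pos hpos (Real.exp_pos _)) h2
  rw [Real.log_mul hpos.ne' (Real.exp_pos _).ne', Real.log_mul (Real.exp_pos _).ne' (by positivity),
    Real.log_exp, Real.log_exp, Real.log_pow] at h5
  have h6 : (I : ℝ) - η ≤ (I - η : ℝ≥0) := by
    rw [NNReal.coe_sub_def]; exact le_max_left _ _
  have h7 : (N : ℝ) * (I - η) ≤ N * (I - η : ℝ≥0) := by gcongr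
  linarith

/-- The logarithm of the mean-field partition function is, to leading order, minus `N` times the
minimal free energy. -/
theorem tendsto_log_gibbsPartition [IsProbabilityMeasure π] (hk : Measurable k)
    (hstep : IsStepApproximable k π) (hf : IsProbDensity π f) (hfin : freeEnergy k π f ≠ ⊤)
    (hmin : ∀ h, IsProbDensity π h → freeEnergy k π f ≤ freeEnergy k π h) :
    Tendsto (fun N : ℕ => Real.log (gibbsPartition k π N).toReal / N) atTop
      (𝓝 (-(freeEnergy k π f).toReal)) := by
  rw [tendsto_order]
  constructor
  · intro a ha
    filter_upwards [eventually_ne_atTop 0] with N hN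
    refine ha.trans_le ?_
    rw [le_div_iff₀ (by positivity)]
    linarith [neg_le_log_gibbsPartition hk hf hfin hN]
  · intro b hb
    set I := (freeEnergy k π f).toReal with hI
    -- Half of the gap between `b` and `-I`, so that the limiting upper bound `-(I - η)` stays below
    -- `b`.
    set η : ℝ≥0 := Real.toNNReal ((b + I) / 2) with hηdef
    have hηpos : 0 < (b + I) / 2 := by linarith
    have hη : (η : ℝ) = (b + I) / 2 := Real.coe_toNNReal _ hηpos.le
    obtain ⟨B, m, H⟩ := log_gibbsPartition_le hk hstep hf hfin hmin (η := η)
      (Real.toNNReal_pos.2 hηpos)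
    have hlog : Tendsto (fun N : ℕ => Real.log (N + 1) / N) atTop (𝓝 0) := by
      have h1 : Tendsto (fun N : ℕ => Real.log ((N : ℝ) + 1) / ((N : ℝ) + 1)) atTop (𝓝 0) := by
        have h0 := (Real.isLittleO_log_id_atTop.tendsto_div_nhds_zero).comp
          (tendsto_atTop_add_const_right _ (1 : ℝ) tendsto_natCast_atTop_atTop)
        exact h0
      have h2 : Tendsto (fun N : ℕ => 1 + 1 / (N : ℝ)) atTop (𝓝 (1 + 0)) :=
        tendsto_const_nhds.add tendsto_one_div_atTop_nhds_zero_nat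
      have h3 := h1.mul h2
      rw [zero_mul] at h3
      refine h3.congr' ?_
      filter_upwards [eventually_ne_atTop 0] with N hN
      have : (N : ℝ) ≠ 0 := by positivity
      field_simp
    have hlim : Tendsto (fun N : ℕ => B / (N : ℝ) + m * (Real.log (N + 1) / N) - (I - η)) atTop
        (𝓝 (0 + m * 0 - (I - η))) :=
      ((tendsto_const_div_atTop_nhds_zero_nat B).add (hlog.const_mul _)).sub_const _
    filter_upwards [hlim.eventually_lt_const (u := b) (by rw [hη]; linarith),
      eventually_ne_atTop 0] with N hNlt hN
    refine lt_of_le_of_lt ?_ hNlt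
    have hN0 : (0 : ℝ) < N := by positivity
    rw [div_le_iff₀ hN0]
    refine (H N hN).trans_eq ?_
    rw [← hI]
    field_simp

end Asymptotics

/-! ### Approximation of kernels by step kernels -/

section StepApproximation

variable {X : Type*} [PseudoMetricSpace X] [CompactSpace X]

/-- The code of a point records which balls of a finite cover of radius `ε / 2` contain it. Two
points with the same code share a ball, so the cover need not be made disjoint. -/
lemma exists_finite_cells [MeasurableSpace X] [OpensMeasurableSpace X] {ε : ℝ} (hε : 0 < ε) :
    ∃ (n : ℕ) (c : X → Fin n → Bool), Measurable c ∧ ∀ x y, c x = c y → dist x y < ε := by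
  classical
  obtain ⟨t, -, htf, ht⟩ := finite_cover_balls_of_compact (isCompact_univ (X := X)) (half_pos hε)
  obtain ⟨n, e, he⟩ : ∃ (n : ℕ) (e : Fin n → X), Set.range e = t := by
    have := htf.fintype
    refine ⟨Fintype.card t, fun i => ((Fintype.equivFin t).symm i : X), ?_⟩
    ext x
    simp only [Set.mem_range]
    exact ⟨fun ⟨i, hi⟩ => hi ▸ Subtype.coe_prop _, fun hx => ⟨Fintype.equivFin t ⟨x, hx⟩, by simp⟩⟩
  refine ⟨n, fun x i => decide (x ∈ Metric.ball (e i) (ε / 2)), ?_, fun x y hxy => ?_⟩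
  · refine measurable_pi_iff.2 fun i => measurable_to_bool ?_
    have : (fun x => decide (x ∈ Metric.ball (e i) (ε / 2))) ⁻¹' {true} =
        Metric.ball (e i) (ε / 2) := by ext x; simp
    rw [this]
    exact measurableSet_ball
  · have hx := ht (Set.mem_univ x)
    rw [← he] at hx
    simp only [Set.mem_range, Set.iUnion_exists, Set.iUnion_iUnion_eq', Set.mem_iUnion] at hx
    obtain ⟨i, hi⟩ := hx
    have h1 : y ∈ Metric.ball (e i) (ε / 2) := (decide_eq_decide.1 (congrFun hxy i)).1 hi
    have h2 := Metric.mem_ball.1 hi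
    have h3 := Metric.mem_ball.1 h1
    linarith [dist_triangle_right x y (e i)]

/-- A nonnegative integrable kernel that is almost everywhere continuous on a compact space is
approximable by step kernels from below. -/
theorem isStepApproximable_of_continuousAt [MeasurableSpace X] [OpensMeasurableSpace X]
    {π : Measure X} {k : X × X → ℝ≥0∞} (hk : Measurable k)
    (hkint : ∫⁻ p, k p ∂(π.prod π) ≠ ⊤) (hcont : ∀ᵐ p ∂(π.prod π), ContinuousAt k p) :
    IsStepApproximable k π := by
  have hcell : ∀ j : ℕ, ∃ (n : ℕ) (c : X → Fin n → Bool), Measurable c ∧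
      ∀ x y, c x = c y → dist x y < 1 / ((j : ℝ) + 1) := fun j => exists_finite_cells (by positivity)
  choose n c hc hdist using hcell
  -- The infimum over a pair of cells stays below `k` and converges to it at continuity points as
  -- the cells shrink. The cap at `j` keeps the kernel bounded, also on empty cells, where the
  -- infimum is `⊤`.
  set S : ∀ j, (Fin (n j) → Bool) → (Fin (n j) → Bool) → ℝ≥0∞ := fun j a b =>
    min (⨅ p : {p : X × X // c j p.1 = a ∧ c j p.2 = b}, k p) j with hS
  have hSk : ∀ j (p : X × X), S j (c j p.1) (c j p.2) ≤ k p := fun j p =>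
    (min_le_left _ _).trans (iInf_le_of_le ⟨p, rfl, rfl⟩ le_rfl)
  have hSm : ∀ j, Measurable fun p : X × X => S j (c j p.1) (c j p.2) := fun j =>
    (measurable_of_finite fun q : (Fin (n j) → Bool) × (Fin (n j) → Bool) => S j q.1 q.2).comp
      (((hc j).comp measurable_fst).prodMk ((hc j).comp measurable_snd))
  have hlim : ∀ᵐ p ∂(π.prod π),
      Tendsto (fun j => k p - S j (c j p.1) (c j p.2)) atTop (𝓝 0) := by
    filter_upwards [hcont, ae_lt_top hk hkint] with p hp hpfin
    have hto : Tendsto (fun j => S j (c j p.1) (c j p.2)) atTop (𝓝 (k p)) := by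
      rw [tendsto_order]
      refine ⟨fun a ha => ?_, fun b hb => Eventually.of_forall fun j => (hSk j p).trans_lt hb⟩
      obtain ⟨a', haa', ha'⟩ := exists_between ha
      obtain ⟨δ, hδ, hball⟩ := Metric.mem_nhds_iff.1 (hp.eventually (lt_mem_nhds ha'))
      have h1 : ∀ᶠ j : ℕ in atTop, 1 / ((j : ℝ) + 1) < δ :=
        tendsto_one_div_add_atTop_nhds_zero_nat.eventually_lt_const hδ
      have h2 : ∀ᶠ j : ℕ in atTop, a' < j :=
        ENNReal.tendsto_nat_nhds_top.eventually (lt_mem_nhds (ha'.trans hpfin))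
      filter_upwards [h1, h2] with j hj1 hj2
      refine haa'.trans_le (le_min (le_iInf fun ⟨q, hq1, hq2⟩ => ?_) hj2.le)
      refine (hball (Metric.mem_ball.2 ?_) : a' < k q).le
      rw [Prod.dist_eq, max_lt_iff]
      exact ⟨(hdist j _ _ hq1).trans hj1, (hdist j _ _ hq2).trans hj1⟩
    have := ENNReal.Tendsto.sub (tendsto_const_nhds (x := k p)) hto (Or.inl hpfin.ne)
    rwa [tsub_self] at this
  have hconv := tendsto_lintegral_of_dominated_convergence (μ := π.prod π) k
    (fun j => hk.sub (hSm j)) (fun j => ae_of_all _ fun p => tsub_le_self) hkint hlim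
  rw [lintegral_zero] at hconv
  intro τ hτ
  obtain ⟨j, hj⟩ := (hconv.eventually (gt_mem_nhds (ENNReal.coe_pos.2 hτ))).exists
  exact ⟨n j, c j, S j, j, hc j, fun a b => (min_le_right _ _).trans (by simp), hSk j, hj.le⟩

end StepApproximation

/-! ### Calculus of extended-real integrals -/

section ERealIntegral

variable {α : Type*} [MeasurableSpace α] {μ : Measure α}

lemma EReal.toENNReal_coe_sub_add (a b : ℝ≥0∞) (hb : b ≠ ⊤) :
    ((a : EReal) - b).toENNReal + b = (-((a : EReal) - b)).toENNReal + a := by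
  lift b to ℝ≥0 using hb
  rcases eq_or_ne a ⊤ with rfl | ha
  · have h : ((⊤ : ℝ≥0∞) : EReal) - ((b : ℝ≥0∞) : EReal) = ⊤ := EReal.top_sub_coe b
    rw [h]; simp
  lift a to ℝ≥0 using ha
  have h : (((a : ℝ≥0∞) : EReal) - ((b : ℝ≥0∞) : EReal)) = (((a : ℝ) - b : ℝ) : EReal) := rfl
  rw [h, ← EReal.coe_neg, EReal.real_coe_toENNReal, EReal.real_coe_toENNReal]
  rw [← ENNReal.ofReal_coe_nnreal (p := a), ← ENNReal.ofReal_coe_nnreal (p := b)]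
  rcases le_total (a : ℝ) b with hab | hab
  · rw [ENNReal.ofReal_of_nonpos (by linarith), zero_add,
      ← ENNReal.ofReal_add (by linarith) a.coe_nonneg]
    congr 1; ring
  · rw [ENNReal.ofReal_of_nonpos (p := -((a : ℝ) - b)) (by linarith), zero_add,
      ← ENNReal.ofReal_add (by linarith) b.coe_nonneg]
    congr 1; ring

lemma EReal.coe_sub_eq_of_add_eq {P Q a b : ℝ≥0∞} (hb : b ≠ ⊤) (hQ : Q ≠ ⊤) (h : P + b = Q + a) :
    (P : EReal) - Q = a - b := by
  lift b to ℝ≥0 using hb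
  lift Q to ℝ≥0 using hQ
  rcases eq_or_ne a ⊤ with rfl | ha
  · have hP : P = ⊤ := by
      by_contra hP
      simp [hP] at h
    rw [hP]
    exact (EReal.top_sub_coe Q).trans (EReal.top_sub_coe b).symm
  have hP : P ≠ ⊤ := by
    rintro rfl
    simp [eq_comm, ha] at h
  lift a to ℝ≥0 using ha
  lift P to ℝ≥0 using hP
  have h' : (P : ℝ) + b = Q + a := by exact_mod_cast h
  change (((P : ℝ) - Q : ℝ) : EReal) = ((a : ℝ) - b : ℝ)
  congr 1
  linarith

lemma erealIntegral_congr_ae {f h : α → EReal} (hfh : f =ᵐ[μ] h) :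
    erealIntegral μ f = erealIntegral μ h := by
  have h1 : ∫⁻ x, (f x).toENNReal ∂μ = ∫⁻ x, (h x).toENNReal ∂μ :=
    lintegral_congr_ae (hfh.fun_comp EReal.toENNReal)
  have h2 : ∫⁻ x, (-f x).toENNReal ∂μ = ∫⁻ x, (-h x).toENNReal ∂μ :=
    lintegral_congr_ae (hfh.fun_comp fun x => (-x).toENNReal)
  rw [erealIntegral, erealIntegral, h1, h2]

/-- The integral can be computed from any decomposition `A - B` with `∫ B` finite: integrate the
pointwise identity `f⁺ + B = f⁻ + A`, in which `f⁻ ≤ B`. -/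
lemma erealIntegral_eq_sub {f : α → EReal} {A B : α → ℝ≥0∞} (hA : Measurable A) (hB : Measurable B)
    (hBfin : ∫⁻ x, B x ∂μ ≠ ⊤) (hf : ∀ᵐ x ∂μ, f x = A x - B x) :
    erealIntegral μ f = ((∫⁻ x, A x ∂μ : ℝ≥0∞) : EReal) - ((∫⁻ x, B x ∂μ : ℝ≥0∞) : EReal) := by
  rw [erealIntegral_congr_ae hf, erealIntegral]
  refine EReal.coe_sub_eq_of_add_eq hBfin ?_ ?_
  · refine ne_top_of_le_ne_top hBfin (lintegral_mono_ae ?_)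
    filter_upwards [ae_lt_top hB hBfin] with x hx
    have h1 : -((A x : EReal) - B x) ≤ B x := by
      rw [EReal.neg_sub (Or.inl (EReal.coe_ennreal_ne_bot _))
        (Or.inr (EReal.coe_ennreal_eq_top_iff.not.2 hx.ne))]
      have h2 : (0 : EReal) ≤ A x := EReal.coe_ennreal_nonneg _
      rw [add_comm, ← sub_eq_add_neg]
      calc (B x : EReal) - A x ≤ B x - 0 := EReal.sub_le_sub le_rfl h2
        _ = B x := by simp
    simpa using EReal.toENNReal_le_toENNReal h1
  · rw [← lintegral_add_right _ hB, ← lintegral_add_right _ hA]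
    refine lintegral_congr_ae ?_
    filter_upwards [ae_lt_top hB hBfin] with x hx
    exact EReal.toENNReal_coe_sub_add _ _ hx.ne

lemma coe_eq_ofReal_sub_ofReal (t : ℝ) :
    (t : EReal) = (ENNReal.ofReal t : EReal) - (ENNReal.ofReal (-t) : EReal) := by
  rcases le_total 0 t with h | h
  · rw [ENNReal.ofReal_of_nonpos (p := -t) (by linarith), EReal.coe_ennreal_zero, sub_zero,
      EReal.coe_ennreal_ofReal, max_eq_left h]
  · rw [ENNReal.ofReal_of_nonpos h, EReal.coe_ennreal_zero, zero_sub,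
      EReal.coe_ennreal_ofReal, max_eq_left (by linarith)]
    simp

lemma erealIntegral_coe (μ : Measure α) (u : α → ℝ) :
    erealIntegral μ (fun x => (u x : EReal)) = ((∫⁻ x, ENNReal.ofReal (u x) ∂μ : ℝ≥0∞) : EReal) -
      ((∫⁻ x, ENNReal.ofReal (-u x) ∂μ : ℝ≥0∞) : EReal) := rfl

lemma erealIntegral_coe_add {u v : α → ℝ} (hu : Measurable u) (hv : Measurable v)
    (hufin : ∫⁻ x, ENNReal.ofReal (-u x) ∂μ ≠ ⊤) (hvfin : ∫⁻ x, ENNReal.ofReal (-v x) ∂μ ≠ ⊤) :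
    erealIntegral μ (fun x => ((u x + v x : ℝ) : EReal)) =
      erealIntegral μ (fun x => (u x : EReal)) + erealIntegral μ (fun x => (v x : EReal)) := by
  have hadd := lintegral_add_left (μ := μ) hu.neg.ennreal_ofReal fun x => ENNReal.ofReal (-v x)
  simp only [Pi.neg_apply] at hadd
  rw [erealIntegral_eq_sub (A := fun x => ENNReal.ofReal (u x) + ENNReal.ofReal (v x))
    (B := fun x => ENNReal.ofReal (-u x) + ENNReal.ofReal (-v x))
    (hu.ennreal_ofReal.add hv.ennreal_ofReal) (hu.neg.ennreal_ofReal.add hv.neg.ennreal_ofReal)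
    (by rw [hadd]; exact ENNReal.add_ne_top.2 ⟨hufin, hvfin⟩), hadd,
    lintegral_add_left hu.ennreal_ofReal, erealIntegral_coe, erealIntegral_coe]
  · rw [EReal.coe_ennreal_add, EReal.coe_ennreal_add, EReal.add_sub_add_comm]
    · exact Or.inl (by simp)
    · exact Or.inl (by simpa using hufin)
  · refine ae_of_all _ fun x => ?_
    rw [EReal.coe_add, EReal.coe_ennreal_add, EReal.coe_ennreal_add, EReal.add_sub_add_comm,
      ← coe_eq_ofReal_sub_ofReal, ← coe_eq_ofReal_sub_ofReal]
    · exact Or.inl (by simp)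
    · exact Or.inl (by simp)

lemma erealIntegral_coe_const_mul {u : α → ℝ} (hu : Measurable u) {θ : ℝ} (hθ : 0 < θ) :
    erealIntegral μ (fun x => ((θ * u x : ℝ) : EReal)) =
      (θ : EReal) * erealIntegral μ (fun x => (u x : EReal)) := by
  simp only [erealIntegral_coe, ← mul_neg, ENNReal.ofReal_mul hθ.le]
  rw [lintegral_const_mul _ hu.ennreal_ofReal,
    lintegral_const_mul (f := fun x => ENNReal.ofReal (-u x)) _ hu.neg.ennreal_ofReal,
    EReal.coe_ennreal_mul, EReal.coe_ennreal_mul, EReal.coe_ennreal_ofReal, max_eq_left hθ.le,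
    EReal.mul_sub_of_nonneg_of_ne_top (EReal.coe_nonneg.2 hθ.le) (EReal.coe_ne_top _)]

lemma erealIntegral_const [IsProbabilityMeasure μ] (c : ℝ) :
    erealIntegral μ (fun _ => (c : EReal)) = c := by
  rw [erealIntegral_coe, lintegral_const, lintegral_const, measure_univ, mul_one, mul_one,
    ← coe_eq_ofReal_sub_ofReal]

lemma erealIntegral_coe_of_integrable {u : α → ℝ} (hu : Integrable u μ) :
    erealIntegral μ (fun x => (u x : EReal)) = ((∫ x, u x ∂μ : ℝ) : EReal) := by
  have h1 : ∫⁻ x, ENNReal.ofReal (u x) ∂μ ≠ ⊤ := (hu.lintegral_lt_top).ne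
  have h2 : ∫⁻ x, ENNReal.ofReal (-u x) ∂μ ≠ ⊤ := (hu.neg.lintegral_lt_top).ne
  rw [erealIntegral_coe, integral_eq_lintegral_pos_part_sub_lintegral_neg_part hu,
    EReal.coe_sub, EReal.coe_ennreal_toReal h1, EReal.coe_ennreal_toReal h2]

/-- `klFun ≥ 0` says `-f log f ≤ 1 - f ≤ 1`. Over a finite reference measure the entropy integrand
thus has an integrable negative part. -/
lemma lintegral_ofReal_neg_log_le (π : Measure α) {f : α → ℝ≥0} (hf : Measurable f) :
    ∫⁻ x, ENNReal.ofReal (-Real.log (f x)) ∂(π.withDensity fun x => (f x : ℝ≥0∞)) ≤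
      π Set.univ := by
  rw [lintegral_withDensity_eq_lintegral_mul _ hf.coe_nnreal_ennreal
    (g := fun x => ENNReal.ofReal (-Real.log (f x)))
    (Real.measurable_log.comp hf.coe_nnreal_real).neg.ennreal_ofReal, ← lintegral_one]
  refine lintegral_mono fun x => ?_
  simp only [Pi.mul_apply]
  rw [← ENNReal.ofReal_coe_nnreal (p := f x), ← ENNReal.ofReal_mul (f x).coe_nonneg,
    ← ENNReal.ofReal_one]
  refine ENNReal.ofReal_le_ofReal ?_
  have := klFun_nonneg (f x).coe_nonneg
  rw [klFun_apply] at this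
  nlinarith [(f x).coe_nonneg]

/-- Infinite entropy is included: `klFun f ≤ f log f + 1` makes the positive part diverge while the
negative part stays finite. -/
lemma erealIntegral_log_density {π : Measure α} [IsProbabilityMeasure π] {f : α → ℝ≥0}
    (hf : IsProbDensity π f) :
    erealIntegral (π.withDensity fun x => (f x : ℝ≥0∞)) (fun x => (Real.log (f x) : EReal)) =
      (relEntropy π f : EReal) := by
  rcases eq_or_ne (relEntropy π f) ⊤ with htop | hfin
  · have h1 : ∫⁻ x, ENNReal.ofReal (Real.log (f x)) ∂(π.withDensity fun x => (f x : ℝ≥0∞)) = ⊤ := by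
      have hlogm : Measurable fun x => ENNReal.ofReal (Real.log (f x)) :=
        (Real.measurable_log.comp hf.measurable.coe_nnreal_real).ennreal_ofReal
      have hle : relEntropy π f ≤
          ∫⁻ x, ENNReal.ofReal (Real.log (f x)) ∂(π.withDensity fun x => (f x : ℝ≥0∞)) + 1 := by
        rw [lintegral_withDensity_eq_lintegral_mul _ hf.measurable.coe_nnreal_ennreal hlogm,
          ← measure_univ (μ := π), ← lintegral_one, ← lintegral_add_right _ measurable_const,
          relEntropy]
        refine lintegral_mono fun x => ?_
        simp only [Pi.mul_apply]
        rw [← ENNReal.ofReal_coe_nnreal (p := f x), ← ENNReal.ofReal_mul (f x).coe_nonneg,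
          ← ENNReal.ofReal_one]
        refine le_trans (ENNReal.ofReal_le_ofReal ?_) ENNReal.ofReal_add_le
        rw [klFun_apply]
        linarith [(f x).coe_nonneg]
      rw [htop, top_le_iff] at hle
      simpa using hle
    have h2 := ne_top_of_le_ne_top (measure_ne_top π _)
      (lintegral_ofReal_neg_log_le π hf.measurable)
    rw [erealIntegral_coe, h1, htop]
    lift ∫⁻ x, ENNReal.ofReal (-Real.log (f x)) ∂(π.withDensity fun x => (f x : ℝ≥0∞)) to ℝ≥0
      using h2 with b
    exact EReal.top_sub_coe b
  · obtain ⟨h1, h2⟩ := integrable_log_density hf hfin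
    rw [erealIntegral_coe_of_integrable h1, h2, EReal.coe_ennreal_toReal hfin]

end ERealIntegral

/-! ### The kernel shifted to be nonnegative -/

section ShiftedKernel

lemma measurable_ereal_abs : Measurable EReal.abs := by
  have h : ∀ a : EReal, a.abs = a.toENNReal + (-a).toENNReal := fun a => by
    induction a with
    | bot => simp
    | top => simp
    | coe a =>
      rw [EReal.real_coe_toENNReal, EReal.abs_def, ← EReal.coe_neg, EReal.real_coe_toENNReal]
      rcases le_total 0 a with h | h
      · rw [abs_of_nonneg h, ENNReal.ofReal_of_nonpos (p := -a) (by linarith), add_zero]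
      · rw [abs_of_nonpos h, ENNReal.ofReal_of_nonpos h, zero_add]
  rw [funext h]
  exact measurable_ereal_toENNReal.add (measurable_neg.ereal_toENNReal)

variable {d : ℕ} {T : ℝ} {g : Torus d T → EReal} {C : ℝ≥0}

/-- The nonnegative kernel `g + C`. -/
noncomputable def shiftedKernel (g : Torus d T → EReal) (C : ℝ≥0) (x : Torus d T) : ℝ≥0∞ :=
  (g x + ((C : ℝ) : EReal)).toENNReal

lemma coe_shiftedKernel (hC : ∀ x, ((-C : ℝ) : EReal) ≤ g x) (x : Torus d T) :
    (shiftedKernel g C x : EReal) = g x + ((C : ℝ) : EReal) := by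
  refine EReal.coe_toENNReal ?_
  calc (0 : EReal) = ((-C : ℝ) : EReal) + ((C : ℝ) : EReal) := by
        rw [← EReal.coe_add]; simp
    _ ≤ _ := by gcongr; exact hC x

lemma eq_shiftedKernel_sub (hC : ∀ x, ((-C : ℝ) : EReal) ≤ g x) (x : Torus d T) :
    g x = (shiftedKernel g C x : EReal) - ((C : ℝ≥0∞) : EReal) := by
  rw [coe_shiftedKernel hC]
  exact (EReal.add_sub_cancel_right (a := g x) (b := (C : ℝ))).symm

lemma shiftedKernel_le_abs (x : Torus d T) : shiftedKernel g C x ≤ (g x).abs + C := by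
  refine EReal.toENNReal_add_le.trans ?_
  rw [EReal.real_coe_toENNReal, ENNReal.ofReal_coe_nnreal]
  gcongr
  induction g x with
  | bot => simp
  | top => simp
  | coe a =>
    rw [EReal.real_coe_toENNReal, EReal.abs_def]
    exact ENNReal.ofReal_le_ofReal (le_abs_self a)

end ShiftedKernel

/-! ### Lower bound, regularity and integrability of the interaction -/

section Interaction

variable {d : ℕ} {T : ℝ} [Fact (0 < T)] {g : Torus d T → EReal} {C : ℝ≥0}

lemma IsAdmissibleInteraction.continuousOn_toReal (hg : IsAdmissibleInteraction g) :
    ContinuousOn (fun x => (g x).toReal) {0}ᶜ := by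
  intro x hx
  have hx0 : 0 < dist x 0 := dist_pos.2 hx
  have h := (hg.uniformContinuous _ (half_pos hx0)).continuousOn x
    (by simp only [Set.mem_compl_iff, Metric.mem_ball, not_lt]; linarith)
  refine (h.continuousAt ?_).continuousWithinAt
  have : {y | dist x 0 / 2 < dist y 0} ∈ 𝓝 x :=
    (isOpen_lt continuous_const (continuous_id.dist continuous_const)).mem_nhds
      (by simp only [Set.mem_ofPred_eq]; exact half_lt_self hx0)
  filter_upwards [this] with y hy
  simp only [Set.mem_compl_iff, Metric.mem_ball, not_lt]
  exact le_of_lt hy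

lemma IsAdmissibleInteraction.coe_toReal (hg : IsAdmissibleInteraction g) {x : Torus d T}
    (hx : x ≠ 0) : ((g x).toReal : EReal) = g x :=
  EReal.coe_toReal (hg.finite_off_zero x hx).1 (hg.finite_off_zero x hx).2

lemma IsAdmissibleInteraction.measurable (hg : IsAdmissibleInteraction g) : Measurable g := by
  refine measurable_of_continuousOn_compl_singleton 0 ?_
  refine (continuous_coe_real_ereal.comp_continuousOn hg.continuousOn_toReal).congr fun x hx => ?_
  exact (hg.coe_toReal hx).symm

/-- Otherwise a measure charging the origin and a sequence along which `g` tends to `-∞` would have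
energy `-∞`. -/
lemma IsAdmissibleInteraction.exists_lower_bound (hg : IsAdmissibleInteraction g) :
    ∃ C : ℝ≥0, ∀ x, ((-C : ℝ) : EReal) ≤ g x := by
  by_contra hcon
  push Not at hcon
  -- The rate is inverse to the weight `w (n + 1)` that the atom at `x n` will carry. The pair `(x
  -- n, 0)` then contributes at least `w 0` to the negative part for every `n`, and the sum
  -- diverges. The atom at the origin is `y 0`.
  choose x hx using fun n : ℕ => hcon (2 ^ (n + 2))
  set y : ℕ → Torus d T := fun n => Nat.casesOn n 0 x with hy
  set w : ℕ → ℝ≥0∞ := fun n => 2⁻¹ ^ (n + 1) with hw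
  set μ : Measure (Torus d T) := Measure.sum fun n => w n • Measure.dirac (y n) with hμ
  have hμ1 : IsProbabilityMeasure μ := by
    refine ⟨?_⟩
    rw [hμ, Measure.sum_apply _ MeasurableSet.univ]
    simp only [Measure.smul_apply, measure_univ, smul_eq_mul, mul_one, hw]
    exact ENNReal.tsum_geometric_add_one _ |>.trans (by
      rw [ENNReal.one_sub_inv_two, inv_inv, ENNReal.inv_mul_cancel two_ne_zero (by simp)])
  have hlt := hg.energy_gt_bot ⟨μ, hμ1⟩
  have hFm : Measurable fun p : Torus d T × Torus d T => (-g (p.1 - p.2)).toENNReal :=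
    ((hg.measurable.comp (measurable_fst.sub measurable_snd)).neg).ereal_toENNReal
  have hneg : ∫⁻ p, (-g (p.1 - p.2)).toENNReal ∂(μ.prod μ) = ⊤ := by
    rw [lintegral_prod _ hFm.aemeasurable]
    have hin : ∀ a, w 0 * (-g (a - 0)).toENNReal ≤ ∫⁻ b, (-g (a - b)).toENNReal ∂μ := fun a => by
      rw [hμ, lintegral_sum_measure]
      refine le_trans (le_of_eq ?_) (ENNReal.le_tsum 0)
      rw [lintegral_smul_measure, lintegral_dirac]
      rfl
    rw [← top_le_iff]
    calc ⊤ = ∑' _ : ℕ, w 0 := by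
          rw [ENNReal.tsum_const_eq_top_of_ne_zero]
          simp [hw]
      _ ≤ ∑' n : ℕ, w (n + 1) * (w 0 * (-g (x n - 0)).toENNReal) := by
          refine ENNReal.tsum_le_tsum fun n => ?_
          have h1 : (2 : ℝ≥0∞) ^ (n + 2) ≤ (-g (x n - 0)).toENNReal := by
            rw [sub_zero]
            have h2 : (((2 ^ (n + 2) : ℝ≥0) : ℝ) : EReal) ≤ -g (x n) := by
              rw [EReal.le_neg]
              exact (hx n).le
            have h3 := EReal.toENNReal_le_toENNReal h2
            rw [EReal.real_coe_toENNReal, ENNReal.ofReal_coe_nnreal] at h3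
            exact_mod_cast h3
          have h4 : w (n + 1) * 2 ^ (n + 2) = 1 := by
            rw [hw, ← mul_pow, ENNReal.inv_mul_cancel two_ne_zero (by simp), one_pow]
          calc w 0 = w 0 * (w (n + 1) * 2 ^ (n + 2)) := by rw [h4, mul_one]
            _ = w (n + 1) * (w 0 * 2 ^ (n + 2)) := by ring
            _ ≤ _ := by gcongr
      _ ≤ ∑' n : ℕ, w n * (w 0 * (-g (y n - 0)).toENNReal) := by
          refine ENNReal.tsum_comp_le_tsum_of_injective (f := fun n : ℕ => n + 1)
            (add_left_injective 1) (fun n => w n * (w 0 * (-g (y n - 0)).toENNReal))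
      _ = ∫⁻ a, w 0 * (-g (a - 0)).toENNReal ∂μ := by
          rw [hμ, lintegral_sum_measure]
          refine tsum_congr fun n => ?_
          rw [lintegral_smul_measure, lintegral_dirac]
          rfl
      _ ≤ _ := lintegral_mono hin
  -- As `⊤ - ⊤ = ⊥`, an infinite negative part decides the value without looking at the positive
  -- part.
  change ⊥ < erealIntegral (μ.prod μ) _ at hlt
  rw [erealIntegral, hneg, EReal.coe_ennreal_top, EReal.sub_top] at hlt
  exact lt_irrefl _ hlt

lemma IsAdmissibleInteraction.measurable_shiftedKernel (hg : IsAdmissibleInteraction g) :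
    Measurable (shiftedKernel g C) :=
  (hg.measurable.add_const _).ereal_toENNReal

lemma IsAdmissibleInteraction.measurable_shiftedKernel_sub (hg : IsAdmissibleInteraction g) :
    Measurable fun p : Torus d T × Torus d T => shiftedKernel g C (p.1 - p.2) :=
  hg.measurable_shiftedKernel.comp (measurable_fst.sub measurable_snd)

lemma IsAdmissibleInteraction.continuousAt_shiftedKernel (hg : IsAdmissibleInteraction g)
    {x : Torus d T} (hx : x ≠ 0) : ContinuousAt (shiftedKernel g C) x := by
  have hmem : ({0}ᶜ : Set (Torus d T)) ∈ 𝓝 x := isOpen_compl_singleton.mem_nhds hx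
  have h1 : ContinuousAt (fun y => ENNReal.ofReal ((g y).toReal + C)) x :=
    ENNReal.continuous_ofReal.continuousAt.comp
      ((hg.continuousOn_toReal.continuousAt hmem).add continuousAt_const)
  refine h1.congr ?_
  filter_upwards [hmem] with y hy
  rw [shiftedKernel, ← hg.coe_toReal hy, EReal.toReal_coe, ← EReal.coe_add, EReal.real_coe_toENNReal]

lemma lintegral_sub_volume_prod {F : Torus d T → ℝ≥0∞} (hF : Measurable F) :
    ∫⁻ p : Torus d T × Torus d T, F (p.1 - p.2) ∂(volume.prod volume) =
      (∫⁻ x, F x) * volume (Set.univ : Set (Torus d T)) := by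
  rw [lintegral_prod_symm (f := fun p : Torus d T × Torus d T => F (p.1 - p.2))
    (hF.comp (measurable_fst.sub measurable_snd)).aemeasurable]
  simp only [lintegral_sub_right_eq_self]
  rw [lintegral_const]

/-- Measures with bounded density have finite interaction energy with an integrable kernel. -/
lemma lintegral_sub_prod_ne_top {F : Torus d T → ℝ≥0∞} (hF : Measurable F) (hFint : ∫⁻ x, F x ≠ ⊤)
    {μ ν : Measure (Torus d T)} {a b : ℝ≥0} (hμ : μ ≤ (a : ℝ≥0∞) • volume)
    (hν : ν ≤ (b : ℝ≥0∞) • volume) :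
    ∫⁻ p, F (p.1 - p.2) ∂(μ.prod ν) ≠ ⊤ := by
  have hle : μ.prod ν ≤ (a * b : ℝ≥0∞) • (volume.prod volume) := by
    refine (Measure.prod_mono hμ hν).trans_eq ?_
    rw [Measure.prod_smul_left, Measure.prod_smul_right, smul_smul]
  refine ne_top_of_le_ne_top ?_ (lintegral_mono' hle le_rfl)
  rw [lintegral_smul_measure, lintegral_sub_volume_prod hF]
  exact ENNReal.mul_ne_top (by finiteness) (ENNReal.mul_ne_top hFint (measure_ne_top _ _))

lemma IsAdmissibleInteraction.lintegral_shiftedKernel_ne_top (hg : IsAdmissibleInteraction g) :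
    ∫⁻ x, shiftedKernel g C x ≠ ⊤ := by
  refine ne_top_of_le_ne_top ?_ (lintegral_mono shiftedKernel_le_abs)
  rw [lintegral_add_right _ measurable_const, lintegral_const]
  exact ENNReal.add_ne_top.2 ⟨hg.integrable.ne, by finiteness⟩

lemma mutualEnergy_eq_sub (hg : IsAdmissibleInteraction g) (hC : ∀ x, ((-C : ℝ) : EReal) ≤ g x)
    (μ ν : Measure (Torus d T)) [IsFiniteMeasure μ] [IsFiniteMeasure ν] :
    mutualEnergy g μ ν = ((∫⁻ p, shiftedKernel g C (p.1 - p.2) ∂(μ.prod ν) : ℝ≥0∞) : EReal) -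
      ((C * (μ Set.univ * ν Set.univ) : ℝ≥0∞) : EReal) := by
  rw [mutualEnergy, erealIntegral_eq_sub hg.measurable_shiftedKernel_sub (B := fun _ => C)
    measurable_const (by rw [lintegral_const]; finiteness)
    (ae_of_all _ fun p => eq_shiftedKernel_sub hC _), lintegral_const, ← Set.univ_prod_univ,
    Measure.prod_prod]

end Interaction

/-! ### Bilinearity of the interaction energy -/

section BilinearEnergy

variable {X : Type*} [MeasurableSpace X] {π : Measure X} {k : X × X → ℝ≥0∞} {f₁ f₂ h₁ h₂ : X → ℝ≥0}

lemma interactionEnergy_add_add (hk : Measurable k) (hf₁ : Measurable f₁) (hf₂ : Measurable f₂)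
    (hh₁ : Measurable h₁) (hh₂ : Measurable h₂) :
    interactionEnergy k π (fun x => f₁ x + f₂ x) (fun x => h₁ x + h₂ x) =
      interactionEnergy k π f₁ h₁ + interactionEnergy k π f₁ h₂ +
        (interactionEnergy k π f₂ h₁ + interactionEnergy k π f₂ h₂) := by
  have hm : ∀ {a b : X → ℝ≥0}, Measurable a → Measurable b →
      Measurable fun p : X × X => k p * (a p.1 * b p.2 : ℝ≥0∞) := fun ha hb =>
    hk.mul (measurable_density_prod ha hb)
  simp only [interactionEnergy]
  rw [← lintegral_add_left (hm hf₁ hh₁), ← lintegral_add_left (hm hf₂ hh₁),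
    ← lintegral_add_left (f := fun p => k p * (f₁ p.1 * h₁ p.2) + k p * (f₁ p.1 * h₂ p.2))
      ((hm hf₁ hh₁).add (hm hf₁ hh₂))]
  refine lintegral_congr fun p => ?_
  push_cast
  ring

lemma interactionEnergy_const_mul {c : ℝ≥0∞} (hc : c ≠ ⊤) :
    interactionEnergy (fun p => c * k p) π f₁ h₁ = c * interactionEnergy k π f₁ h₁ := by
  rw [interactionEnergy, interactionEnergy, ← lintegral_const_mul' _ _ hc]
  exact lintegral_congr fun p => mul_assoc _ _ _

end BilinearEnergy

/-! ### Convexity from weak positive definiteness -/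

section Convexity

variable {d : ℕ} {T : ℝ} [Fact (0 < T)] {g : Torus d T → EReal} {C : ℝ≥0}

/-- Weak positive definiteness, tested against a difference of mutually singular measures with
bounded densities. -/
lemma IsAdmissibleInteraction.mutual_le_of_mutuallySingular (hg : IsAdmissibleInteraction g)
    (hC : ∀ x, ((-C : ℝ) : EReal) ≤ g x) {μ ν : Measure (Torus d T)} [IsFiniteMeasure μ]
    [IsFiniteMeasure ν] (hμν : μ ⟂ₘ ν) (hmass : μ Set.univ = ν Set.univ) {a : ℝ≥0}
    (hμ : μ ≤ (a : ℝ≥0∞) • volume) (hν : ν ≤ (a : ℝ≥0∞) • volume) :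
    ∫⁻ p, shiftedKernel g C (p.1 - p.2) ∂(μ.prod ν) +
        ∫⁻ p, shiftedKernel g C (p.1 - p.2) ∂(ν.prod μ) ≤
      ∫⁻ p, shiftedKernel g C (p.1 - p.2) ∂(μ.prod μ) +
        ∫⁻ p, shiftedKernel g C (p.1 - p.2) ∂(ν.prod ν) := by
  -- Mutual singularity makes `(μ, ν)` the Jordan decomposition of `μ - ν`, so `signedEnergy`
  -- unfolds to the four mutual energies of `μ` and `ν`.
  set J : JordanDecomposition (Torus d T) := ⟨μ, ν, hμν⟩ with hJ
  have hJd : J.toSignedMeasure.toJordanDecomposition = J :=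
    JordanDecomposition.toJordanDecomposition_toSignedMeasure J
  have hzero : J.toSignedMeasure Set.univ = 0 := by
    rw [JordanDecomposition.toSignedMeasure, sub_apply,
      Measure.toSignedMeasure_apply_measurable MeasurableSet.univ,
      Measure.toSignedMeasure_apply_measurable MeasurableSet.univ, measureReal_def, measureReal_def]
    simp [hJ, hmass]
  have hfin : HasFiniteSignedEnergy g J.toSignedMeasure := by
    rw [HasFiniteSignedEnergy, SignedMeasure.totalVariation, hJd]
    have hle : μ + ν ≤ ((a + a : ℝ≥0) : ℝ≥0∞) • volume := by
      rw [ENNReal.coe_add, add_smul]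
      exact add_le_add hμ hν
    exact (lintegral_sub_prod_ne_top (F := fun x => (g x).abs)
      (measurable_ereal_abs.comp hg.measurable) hg.integrable.ne hle hle).lt_top
  have hpos := hg.weakly_positive_definite _ hzero hfin
  have hfinK : ∀ {μ' ν' : Measure (Torus d T)}, μ' ≤ (a : ℝ≥0∞) • volume →
      ν' ≤ (a : ℝ≥0∞) • volume → ∫⁻ p, shiftedKernel g C (p.1 - p.2) ∂(μ'.prod ν') ≠ ⊤ :=
    fun h h' => lintegral_sub_prod_ne_top hg.measurable_shiftedKernel
      hg.lintegral_shiftedKernel_ne_top h h'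
  simp only [signedEnergy, hJd] at hpos
  change 0 ≤ mutualEnergy g μ μ + mutualEnergy g ν ν - mutualEnergy g μ ν -
    mutualEnergy g ν μ at hpos
  -- Because the masses agree, the shift by `C` contributes the same finite amount to all four
  -- energies and cancels.
  rw [mutualEnergy_eq_sub hg hC, mutualEnergy_eq_sub hg hC, mutualEnergy_eq_sub hg hC,
    mutualEnergy_eq_sub hg hC, hmass] at hpos
  have h1 := hfinK hμ hμ
  have h2 := hfinK hν hν
  have h3 := hfinK hμ hν
  have h4 := hfinK hν hμ
  have h5 : (C : ℝ≥0∞) * (ν Set.univ * ν Set.univ) ≠ ⊤ := by finiteness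
  lift ∫⁻ p, shiftedKernel g C (p.1 - p.2) ∂(μ.prod μ) to ℝ≥0 using h1 with e1
  lift ∫⁻ p, shiftedKernel g C (p.1 - p.2) ∂(ν.prod ν) to ℝ≥0 using h2 with e2
  lift ∫⁻ p, shiftedKernel g C (p.1 - p.2) ∂(μ.prod ν) to ℝ≥0 using h3 with e3
  lift ∫⁻ p, shiftedKernel g C (p.1 - p.2) ∂(ν.prod μ) to ℝ≥0 using h4 with e4
  lift (C : ℝ≥0∞) * (ν Set.univ * ν Set.univ) to ℝ≥0 using h5 with e5
  have hreal : (0 : ℝ) ≤ ((e1 : ℝ) - e5) + (e2 - e5) - (e3 - e5) - (e4 - e5) := by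
    have : ((0 : ℝ) : EReal) ≤
        ((((e1 : ℝ) - e5) + (e2 - e5) - (e3 - e5) - (e4 - e5) : ℝ) : EReal) := hpos
    exact_mod_cast this
  have : (e3 : ℝ) + e4 ≤ e1 + e2 := by linarith
  exact_mod_cast this

/-- The interaction energy is convex on bounded densities. -/
theorem IsAdmissibleInteraction.interactionEnergy_convex (hg : IsAdmissibleInteraction g)
    (hC : ∀ x, ((-C : ℝ) : EReal) ≤ g x) {π : Measure (Torus d T)} [IsProbabilityMeasure π]
    {W : ℝ≥0} (hπ : π ≤ (W : ℝ≥0∞) • volume) {M : ℝ≥0} {f h : Torus d T → ℝ≥0}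
    (hf : IsProbDensity π f) (hh : IsProbDensity π h) (hfM : ∀ x, f x ≤ M) (hhM : ∀ x, h x ≤ M) :
    interactionEnergy (fun p => shiftedKernel g C (p.1 - p.2)) π f h +
        interactionEnergy (fun p => shiftedKernel g C (p.1 - p.2)) π h f ≤
      interactionEnergy (fun p => shiftedKernel g C (p.1 - p.2)) π f f +
        interactionEnergy (fun p => shiftedKernel g C (p.1 - p.2)) π h h := by
  set k : Torus d T × Torus d T → ℝ≥0∞ := fun p => shiftedKernel g C (p.1 - p.2) with hkdef
  have hk : Measurable k := hg.measurable_shiftedKernel_sub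
  -- Removing the common part leaves `(f - h)⁺` and `(f - h)⁻`, which are mutually singular and of
  -- equal mass. By bilinearity the terms containing `r` are the same on both sides, so the claim
  -- reduces to these two.
  set r : Torus d T → ℝ≥0 := fun x => min (f x) (h x) with hr
  set p : Torus d T → ℝ≥0 := fun x => f x - h x with hp
  set n : Torus d T → ℝ≥0 := fun x => h x - f x with hn
  have hrm : Measurable r := hf.measurable.min hh.measurable
  have hpm : Measurable p := hf.measurable.sub hh.measurable
  have hnm : Measurable n := hh.measurable.sub hf.measurable
  have ef : f = fun x => r x + p x := by
    funext x; exact (add_comm _ _).trans tsub_add_min |>.symm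
  have eh : h = fun x => r x + n x := by
    funext x; simp only [hr, hn]; rw [min_comm, add_comm]; exact tsub_add_min.symm
  have hbound : ∀ q : Torus d T → ℝ≥0, (∀ x, q x ≤ M) →
      π.withDensity (fun x => (q x : ℝ≥0∞)) ≤ ((M * W : ℝ≥0) : ℝ≥0∞) • volume := fun q hq => by
    calc π.withDensity (fun x => (q x : ℝ≥0∞)) ≤ π.withDensity fun _ => (M : ℝ≥0∞) :=
          withDensity_mono (ae_of_all _ fun x => ENNReal.coe_le_coe.2 (hq x))
      _ = (M : ℝ≥0∞) • π := withDensity_const _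
      _ ≤ (M : ℝ≥0∞) • ((W : ℝ≥0∞) • volume) := by gcongr
      _ = _ := by rw [smul_smul, ENNReal.coe_mul]
  have hfinite : ∀ q : Torus d T → ℝ≥0, (∀ x, q x ≤ M) →
      IsFiniteMeasure (π.withDensity fun x => (q x : ℝ≥0∞)) := fun q hq =>
    have := Measure.smul_finite (volume : Measure (Torus d T)) (ENNReal.coe_ne_top (r := M * W))
    isFiniteMeasure_of_le _ (hbound q hq)
  have hpM : ∀ x, p x ≤ M := fun x => tsub_le_self.trans (hfM x)
  have hnM : ∀ x, n x ≤ M := fun x => tsub_le_self.trans (hhM x)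
  have hrM : ∀ x, r x ≤ M := fun x => (min_le_left _ _).trans (hfM x)
  have := hfinite p hpM
  have := hfinite n hnM
  have hsing : π.withDensity (fun x => (p x : ℝ≥0∞)) ⟂ₘ π.withDensity fun x => (n x : ℝ≥0∞) := by
    refine ⟨{x | f x ≤ h x}, measurableSet_le hf.measurable hh.measurable, ?_, ?_⟩
    · rw [withDensity_apply _ (measurableSet_le hf.measurable hh.measurable)]
      refine setLIntegral_eq_zero (measurableSet_le hf.measurable hh.measurable) fun x hx => ?_
      simp only [hp, Pi.zero_apply, ENNReal.coe_eq_zero]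
      exact tsub_eq_zero_of_le hx
    · rw [withDensity_apply _ (measurableSet_le hf.measurable hh.measurable).compl]
      refine setLIntegral_eq_zero (measurableSet_le hf.measurable hh.measurable).compl fun x hx => ?_
      simp only [hn, Pi.zero_apply, ENNReal.coe_eq_zero]
      exact tsub_eq_zero_of_le (le_of_lt (not_le.1 hx))
  have hmass : π.withDensity (fun x => (p x : ℝ≥0∞)) Set.univ =
      π.withDensity (fun x => (n x : ℝ≥0∞)) Set.univ := by
    rw [withDensity_apply _ MeasurableSet.univ, withDensity_apply _ MeasurableSet.univ,
      Measure.restrict_univ]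
    have h1 := hf.lintegral_eq_one
    have h2 := hh.lintegral_eq_one
    rw [ef] at h1
    rw [eh] at h2
    simp only [ENNReal.coe_add] at h1 h2
    rw [lintegral_add_left hrm.coe_nnreal_ennreal] at h1 h2
    have hrfin : ∫⁻ x, (r x : ℝ≥0∞) ∂π ≠ ⊤ := by
      intro htop
      rw [htop, top_add] at h1
      exact ENNReal.top_ne_one h1
    exact (ENNReal.add_right_inj hrfin).1 (h1.trans h2.symm)
  have hmain := hg.mutual_le_of_mutuallySingular hC hsing hmass (hbound p hpM) (hbound n hnM)
  rw [lintegral_prod_withDensity hk hpm hnm, lintegral_prod_withDensity hk hnm hpm,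
    lintegral_prod_withDensity hk hpm hpm, lintegral_prod_withDensity hk hnm hnm] at hmain
  rw [ef, eh]
  simp only [interactionEnergy_add_add hk hrm hpm hrm hnm, interactionEnergy_add_add hk hrm hnm hrm hpm,
    interactionEnergy_add_add hk hrm hpm hrm hpm, interactionEnergy_add_add hk hrm hnm hrm hnm]
  set E := fun a b => interactionEnergy k π a b
  calc E r r + E r n + (E p r + E p n) + (E r r + E r p + (E n r + E n p))
      = (E r r + E r n + E p r + E r r + E r p + E n r) + (E p n + E n p) := by ring
    _ ≤ (E r r + E r n + E p r + E r r + E r p + E n r) + (E p p + E n n) := by gcongr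
    _ = _ := by ring

end Convexity

/-! ### Thermal energy as a free energy relative to the Gibbs weight -/

section ThermalEnergy

variable {d : ℕ} {T : ℝ} [Fact (0 < T)] {g : Torus d T → EReal} {C : ℝ≥0} {V : Torus d T → ℝ}
  {θ c : ℝ} {w : Torus d T → ℝ≥0}

/-- `w` is the density of the normalized Gibbs weight `exp (-θ V) / c`. -/
structure IsGibbsWeight (V : Torus d T → ℝ) (θ c : ℝ) (w : Torus d T → ℝ≥0) : Prop where
  const_pos : 0 < c
  measurable : Measurable w
  coe_eq : ∀ x, (w x : ℝ) = Real.exp (-(θ * V x)) / c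
  bounded : ∃ W : ℝ≥0, ∀ x, w x ≤ W
  isProbabilityMeasure : IsProbabilityMeasure (volume.withDensity fun x => (w x : ℝ≥0∞))

instance : NeZero (volume : Measure (Torus d T)) := by
  refine ⟨fun h => ?_⟩
  have h1 : (volume : Measure (Torus d T)) Set.univ = 0 := by rw [h]; rfl
  have h2 : (volume : Measure (Torus d T)) Set.univ = ∏ _i : Fin d, ENNReal.ofReal T := by
    rw [← Set.pi_univ Set.univ, volume_pi_pi]
    simp [AddCircle.measure_univ]
  rw [h2, Finset.prod_const] at h1
  exact (pow_ne_zero _ (ENNReal.ofReal_pos.2 Fact.out).ne') h1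

lemma IsAdmissiblePotential.exists_lower_bound (hV : IsAdmissiblePotential V) :
    ∃ B : ℝ, ∀ x, B ≤ V x := by
  obtain ⟨x, -, hx⟩ := (hV.lowerSemicontinuous.lowerSemicontinuousOn Set.univ).exists_isMinOn
    (Set.univ_nonempty) isCompact_univ
  exact ⟨V x, fun y => hx (Set.mem_univ y)⟩

lemma IsAdmissiblePotential.exists_gibbsWeight (hV : IsAdmissiblePotential V) (hθ : 0 < θ) :
    ∃ (c : ℝ) (w : Torus d T → ℝ≥0), IsGibbsWeight V θ c w := by
  obtain ⟨B, hB⟩ := hV.exists_lower_bound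
  have hVm : Measurable V := hV.lowerSemicontinuous.measurable
  have hem : Measurable fun x => Real.exp (-(θ * V x)) := (hVm.const_mul θ).neg.exp
  have hle : ∀ x, Real.exp (-(θ * V x)) ≤ Real.exp (-(θ * B)) := fun x => by
    gcongr; exact hB x
  have hint : Integrable (fun x => Real.exp (-(θ * V x))) (volume : Measure (Torus d T)) := by
    refine Integrable.of_bound hem.aestronglyMeasurable (Real.exp (-(θ * B))) (ae_of_all _ fun x => ?_)
    rw [Real.norm_eq_abs, abs_of_pos (Real.exp_pos _)]
    exact hle x
  set c := ∫ x, Real.exp (-(θ * V x)) with hc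
  have hcpos : 0 < c := integral_exp_pos hint
  refine ⟨c, fun x => Real.toNNReal (Real.exp (-(θ * V x)) / c), hcpos,
    (hem.div_const c).real_toNNReal, fun x => Real.coe_toNNReal _ (by positivity),
    ⟨Real.toNNReal (Real.exp (-(θ * B)) / c), fun x => Real.toNNReal_le_toNNReal ?_⟩, ⟨?_⟩⟩
  · gcongr; exact hB x
  · rw [withDensity_apply _ MeasurableSet.univ, Measure.restrict_univ]
    change ∫⁻ x, ENNReal.ofReal (Real.exp (-(θ * V x)) / c) = 1
    rw [← ofReal_integral_eq_lintegral_ofReal (hint.div_const c)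
      (ae_of_all _ fun x => by positivity), integral_div, ← hc, div_self hcpos.ne',
      ENNReal.ofReal_one]

lemma IsGibbsWeight.pos (hw : IsGibbsWeight V θ c w) (x : Torus d T) : 0 < w x := by
  rw [← NNReal.coe_pos, hw.coe_eq]
  exact div_pos (Real.exp_pos _) hw.const_pos

lemma IsGibbsWeight.log_eq (hw : IsGibbsWeight V θ c w) (x : Torus d T) :
    Real.log (w x) = -(θ * V x) - Real.log c := by
  rw [hw.coe_eq, Real.log_div (Real.exp_pos _).ne' hw.const_pos.ne', Real.log_exp]

lemma IsGibbsWeight.withDensity_le (hw : IsGibbsWeight V θ c w) :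
    ∃ W : ℝ≥0, volume.withDensity (fun x => (w x : ℝ≥0∞)) ≤ (W : ℝ≥0∞) • volume := by
  obtain ⟨W, hW⟩ := hw.bounded
  refine ⟨W, ?_⟩
  rw [← withDensity_const]
  exact withDensity_mono (ae_of_all _ fun x => ENNReal.coe_le_coe.2 (hW x))

lemma IsGibbsWeight.absolutelyContinuous (hw : IsGibbsWeight V θ c w) :
    (volume : Measure (Torus d T)) ≪ volume.withDensity fun x => (w x : ℝ≥0∞) :=
  withDensity_absolutelyContinuous' hw.measurable.coe_nnreal_ennreal.aemeasurable
    (ae_of_all _ fun x => by simpa using (hw.pos x).ne')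

lemma exists_density_of_absolutelyContinuous {X : Type*} [MeasurableSpace X] {μ π : Measure X}
    [IsProbabilityMeasure μ] [SigmaFinite π] (h : μ ≪ π) :
    ∃ f : X → ℝ≥0, IsProbDensity π f ∧ μ = π.withDensity fun x => (f x : ℝ≥0∞) := by
  have he : μ = π.withDensity fun x => ((μ.rnDeriv π x).toNNReal : ℝ≥0∞) := by
    conv_lhs => rw [← Measure.withDensity_rnDeriv_eq μ π h]
    refine withDensity_congr_ae ?_
    filter_upwards [Measure.rnDeriv_lt_top μ π] with x hx
    exact (ENNReal.coe_toNNReal hx.ne).symm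
  refine ⟨fun x => (μ.rnDeriv π x).toNNReal,
    ⟨(Measure.measurable_rnDeriv μ π).ennreal_toNNReal, ?_⟩, he⟩
  rw [← setLIntegral_univ, ← withDensity_apply _ MeasurableSet.univ, ← he, measure_univ]

lemma entropy_withDensity {ρ : Torus d T → ℝ≥0} (hρ : Measurable ρ) :
    entropy (volume.withDensity fun x => (ρ x : ℝ≥0∞)) =
      erealIntegral (volume.withDensity fun x => (ρ x : ℝ≥0∞))
        fun x => (Real.log (ρ x) : EReal) := by
  have hac := withDensity_absolutelyContinuous (volume : Measure (Torus d T))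
    fun x => (ρ x : ℝ≥0∞)
  rw [entropy, if_pos hac]
  refine erealIntegral_congr_ae ?_
  have h1 := hac.ae_le (Measure.rnDeriv_withDensity (volume : Measure (Torus d T))
    hρ.coe_nnreal_ennreal)
  have h2 : ∀ᵐ x ∂(volume.withDensity fun x => (ρ x : ℝ≥0∞)), ρ x ≠ 0 := by
    rw [ae_withDensity_iff hρ.coe_nnreal_ennreal]
    exact ae_of_all _ fun y hy => by simpa using hy
  filter_upwards [h1, h2] with x hx hx0
  rw [hx, ENNReal.log_of_nnreal hx0]

/-- The potential energy and the entropy combine to the relative entropy with respect to the Gibbs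
weight. -/
lemma IsGibbsWeight.mul_potential_add_entropy (hV : IsAdmissiblePotential V) (hθ : 0 < θ)
    (hw : IsGibbsWeight V θ c w) {f : Torus d T → ℝ≥0}
    (hf : IsProbDensity (volume.withDensity fun x => (w x : ℝ≥0∞)) f) {μ : Measure (Torus d T)}
    (hμ : μ = (volume.withDensity fun x => (w x : ℝ≥0∞)).withDensity fun x => (f x : ℝ≥0∞)) :
    (θ : EReal) * erealIntegral μ (fun x => (V x : EReal)) + entropy μ =
      (relEntropy (volume.withDensity fun x => (w x : ℝ≥0∞)) f : EReal) +
        ((-Real.log c : ℝ) : EReal) := by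
  have := hw.isProbabilityMeasure
  have hprob : IsProbabilityMeasure μ := hμ ▸ hf.isProbabilityMeasure
  obtain ⟨B, hB⟩ := hV.exists_lower_bound
  have hVm : Measurable V := hV.lowerSemicontinuous.measurable
  have hρm : Measurable fun x => w x * f x := hw.measurable.mul hf.measurable
  have hμρ : μ = volume.withDensity fun x => ((w x * f x : ℝ≥0) : ℝ≥0∞) := by
    rw [hμ, ← withDensity_mul _ hw.measurable.coe_nnreal_ennreal hf.measurable.coe_nnreal_ennreal]
    congr 1
  have hfpos : ∀ᵐ x ∂μ, f x ≠ 0 := by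
    rw [hμ, ae_withDensity_iff hf.measurable.coe_nnreal_ennreal]
    exact ae_of_all _ fun y hy => by simpa using hy
  have hent : entropy μ = erealIntegral μ fun x => (Real.log (w x * f x : ℝ≥0) : EReal) := by
    rw [hμρ]; exact entropy_withDensity hρm
  -- Additivity of `erealIntegral` only needs finite negative parts. These hold since `V` is bounded
  -- below and by `lintegral_ofReal_neg_log_le`; the positive parts may be infinite.
  have hVneg : ∫⁻ x, ENNReal.ofReal (-(θ * V x)) ∂μ ≠ ⊤ := by
    refine ne_top_of_le_ne_top (b := ∫⁻ _, ENNReal.ofReal (-(θ * B)) ∂μ) (by simp) ?_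
    refine lintegral_mono fun x => ENNReal.ofReal_le_ofReal ?_
    have := mul_le_mul_of_nonneg_left (hB x) hθ.le
    linarith
  have hLneg : ∫⁻ x, ENNReal.ofReal (-Real.log (w x * f x : ℝ≥0)) ∂μ ≠ ⊤ := by
    rw [hμρ]
    exact ne_top_of_le_ne_top (measure_ne_top _ _) (lintegral_ofReal_neg_log_le volume hρm)
  have hfneg : ∫⁻ x, ENNReal.ofReal (-Real.log (f x)) ∂μ ≠ ⊤ := by
    rw [hμ]
    exact ne_top_of_le_ne_top (measure_ne_top _ _) (lintegral_ofReal_neg_log_le _ hf.measurable)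
  rw [hent, ← erealIntegral_coe_const_mul hVm hθ, ← erealIntegral_coe_add
    (v := fun x => Real.log (w x * f x : ℝ≥0)) (hVm.const_mul θ)
    (Real.measurable_log.comp hρm.coe_nnreal_real) hVneg hLneg, ← erealIntegral_log_density hf, ← hμ,
    ← erealIntegral_const (μ := μ) (-Real.log c), ← erealIntegral_coe_add
      (u := fun x => Real.log (f x)) (Real.measurable_log.comp hf.measurable.coe_nnreal_real) measurable_const hfneg (by simp)]
  refine erealIntegral_congr_ae ?_
  filter_upwards [hfpos] with x hx
  congr 1
  rw [NNReal.coe_mul, Real.log_mul (by simpa using (hw.pos x).ne') (by simpa using hx), hw.log_eq]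
  ring

/-- The kernel of the free energy functional associated to the thermal energy. -/
noncomputable def thermalKernel (g : Torus d T → EReal) (C : ℝ≥0) (θ : ℝ)
    (p : Torus d T × Torus d T) : ℝ≥0∞ :=
  ENNReal.ofReal θ * shiftedKernel g C (p.1 - p.2)

/-- The thermal energy is an affine function of the free energy. -/
lemma thermalEnergy_eq_freeEnergy (hg : IsAdmissibleInteraction g)
    (hC : ∀ x, ((-C : ℝ) : EReal) ≤ g x) (hV : IsAdmissiblePotential V) (hθ : 0 < θ)
    (hw : IsGibbsWeight V θ c w) {f : Torus d T → ℝ≥0}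
    (hf : IsProbDensity (volume.withDensity fun x => (w x : ℝ≥0∞)) f) {μ : Measure (Torus d T)}
    (hμ : μ = (volume.withDensity fun x => (w x : ℝ≥0∞)).withDensity fun x => (f x : ℝ≥0∞)) :
    thermalEnergy g V θ μ = ((1 / θ : ℝ) : EReal) *
      (freeEnergy (thermalKernel g C θ) (volume.withDensity fun x => (w x : ℝ≥0∞)) f : EReal) +
        ((-C - Real.log c / θ : ℝ) : EReal) := by
  have := hw.isProbabilityMeasure
  have hprob : IsProbabilityMeasure μ := hμ ▸ hf.isProbabilityMeasure
  set π := volume.withDensity fun x => (w x : ℝ≥0∞) with hπ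
  have hinv : (0 : EReal) ≤ ((1 / θ : ℝ) : EReal) := EReal.coe_nonneg.2 (by positivity)
  have hcancel : ∀ a : EReal, ((1 / θ : ℝ) : EReal) * ((θ : EReal) * a) = a := fun a => by
    rw [← mul_assoc, ← EReal.coe_mul, one_div_mul_cancel hθ.ne', EReal.coe_one, one_mul]
  set S := interactionEnergy (fun p => shiftedKernel g C (p.1 - p.2)) π f f with hS
  have hself : selfEnergy g μ = (S : EReal) + ((-C : ℝ) : EReal) := by
    rw [selfEnergy, mutualEnergy_eq_sub hg hC, measure_univ, mul_one, mul_one, hS,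
      ← lintegral_prod_withDensity hg.measurable_shiftedKernel_sub hf.measurable hf.measurable, ← hμ,
      EReal.coe_neg, sub_eq_add_neg]
    rfl
  have hK : interactionEnergy (thermalKernel g C θ) π f f = ENNReal.ofReal θ * S :=
    interactionEnergy_const_mul ENNReal.ofReal_ne_top
  have hent := hw.mul_potential_add_entropy hV hθ hf hμ
  rw [← hπ] at hent
  have hrest : erealIntegral μ (fun x => (V x : EReal)) + ((1 / θ : ℝ) : EReal) * entropy μ =
      ((1 / θ : ℝ) : EReal) * (relEntropy π f : EReal) + ((-Real.log c / θ : ℝ) : EReal) := by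
    have h1 := congrArg (fun a => ((1 / θ : ℝ) : EReal) * a) hent
    rw [EReal.left_distrib_of_nonneg_of_ne_top hinv (EReal.coe_ne_top _),
      EReal.left_distrib_of_nonneg_of_ne_top hinv (EReal.coe_ne_top _), hcancel,
      ← EReal.coe_mul] at h1
    rw [h1]
    congr 2
    ring
  rw [thermalEnergy, meanFieldEnergy, add_assoc, hrest, hself, freeEnergy, hK, EReal.coe_ennreal_add,
    EReal.left_distrib_of_nonneg_of_ne_top hinv (EReal.coe_ne_top _), EReal.coe_ennreal_mul,
    EReal.coe_ennreal_ofReal, max_eq_left hθ.le, hcancel,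
    show ((-C - Real.log c / θ : ℝ) : EReal) = ((-C : ℝ) : EReal) + ((-Real.log c / θ : ℝ) : EReal) by
      rw [← EReal.coe_add]; congr 1; ring]
  abel

/-- The entropy is `⊤`, and it is not absorbed by `⊥`: the interaction is above `⊥` by assumption
and the potential energy because `V` is bounded below. -/
lemma thermalEnergy_of_not_absolutelyContinuous (hg : IsAdmissibleInteraction g)
    (hV : IsAdmissiblePotential V) (hθ : 0 < θ) (μ : ProbabilityMeasure (Torus d T))
    (hμ : ¬ (μ : Measure (Torus d T)) ≪ volume) :
    thermalEnergy g V θ (μ : Measure (Torus d T)) = ⊤ := by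
  rw [thermalEnergy, meanFieldEnergy, entropy, if_neg hμ,
    EReal.coe_mul_top_of_pos (by positivity)]
  refine EReal.add_top_of_ne_bot (EReal.add_ne_bot_iff.2 ⟨(hg.energy_gt_bot μ).ne', ?_⟩)
  obtain ⟨B, hB⟩ := hV.exists_lower_bound
  have hVneg : ∫⁻ x, ENNReal.ofReal (-V x) ∂(μ : Measure (Torus d T)) ≠ ⊤ := by
    refine ne_top_of_le_ne_top (b := ∫⁻ _, ENNReal.ofReal (-B) ∂(μ : Measure (Torus d T)))
      (by simp) ?_
    exact lintegral_mono fun x => ENNReal.ofReal_le_ofReal (by linarith [hB x])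
  rw [erealIntegral_coe, sub_eq_add_neg, EReal.add_ne_bot_iff]
  refine ⟨EReal.coe_ennreal_ne_bot _, ?_⟩
  rw [Ne, EReal.neg_eq_bot_iff, EReal.coe_ennreal_eq_top_iff]
  exact hVneg

end ThermalEnergy

/-! ### Pair sums of the shifted kernel -/

section InteractionSum

variable {d : ℕ} {T : ℝ} {g : Torus d T → EReal} {C : ℝ≥0} {θ : ℝ}

lemma sum_interaction (hC : ∀ x, ((-C : ℝ) : EReal) ≤ g x) {ι : Type*} (s : Finset ι)
    (z : ι → Torus d T) :
    ∑ p ∈ s, g (z p) =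
      ((∑ p ∈ s, shiftedKernel g C (z p) : ℝ≥0∞) : EReal) + ((-(s.card * C) : ℝ) : EReal) := by
  classical
  induction s using Finset.induction_on with
  | empty => simp
  | insert a s ha ih =>
    have h : g (z a) = (shiftedKernel g C (z a) : EReal) + ((-C : ℝ) : EReal) := by
      rw [eq_shiftedKernel_sub hC, EReal.coe_neg, sub_eq_add_neg]; rfl
    rw [Finset.sum_insert ha, Finset.sum_insert ha, Finset.card_insert_of_notMem ha, ih, h,
      EReal.coe_ennreal_add,
      show ((-(((s.card + 1 : ℕ) : ℝ) * C) : ℝ) : EReal) =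
        ((-C : ℝ) : EReal) + ((-(s.card * C) : ℝ) : EReal) by
          rw [← EReal.coe_add]; congr 1; push_cast; ring]
    abel

lemma pairEnergy_thermalKernel {N : ℕ} (hN : N ≠ 0) (X : Fin N → Torus d T) :
    pairEnergy (thermalKernel g C θ) N X = ENNReal.ofReal (θ / N) *
      ∑ p ∈ (Finset.univ : Finset (Fin N)).offDiag, shiftedKernel g C (X p.1 - X p.2) := by
  simp only [pairEnergy, thermalKernel]
  rw [← Finset.mul_sum, ← mul_assoc, ENNReal.ofReal_div_of_pos (by positivity),
    ENNReal.ofReal_natCast, ENNReal.div_eq_inv_mul]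

end InteractionSum

/-! ### Transfer to the partition function and to equilibrium measures -/

section PartitionFunction

variable {d : ℕ} {T : ℝ} [Fact (0 < T)] {g : Torus d T → EReal} {C : ℝ≥0} {V : Torus d T → ℝ}
  {θ c : ℝ} {w : Torus d T → ℝ≥0}

instance : NullSingletonClass (volume : Measure (AddCircle T)) := by
  refine ⟨fun x => ?_⟩
  have h : Tendsto (fun ε : ℝ => ENNReal.ofReal (2 * ε)) (𝓝[>] 0) (𝓝 0) := by
    have h1 := (ENNReal.continuous_ofReal.comp (continuous_const_mul (2 : ℝ))).tendsto 0
    simp only [Function.comp_apply, mul_zero, ENNReal.ofReal_zero] at h1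
    exact h1.mono_left nhdsWithin_le_nhds
  refine le_antisymm (ge_of_tendsto h ?_) bot_le
  filter_upwards [self_mem_nhdsWithin] with ε hε
  calc volume {x} ≤ volume (Metric.closedBall x ε) :=
        measure_mono (Set.singleton_subset_iff.2 (Metric.mem_closedBall_self (le_of_lt hε)))
    _ ≤ _ := by
        rw [AddCircle.volume_closedBall]
        exact ENNReal.ofReal_le_ofReal (min_le_right _ _)

lemma measure_prod_diagonal {X : Type*} [MeasurableSpace X] [MeasurableEq X]
    {π : Measure X} [SFinite π] [NullSingletonClass π] : ∀ᵐ p ∂(π.prod π), p.1 ≠ p.2 := by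
  have hm : MeasurableSet {p : X × X | p.1 = p.2} :=
    measurableSet_eq_fun measurable_fst measurable_snd
  have h : (π.prod π) {p : X × X | p.1 = p.2} = 0 := by
    rw [Measure.measure_prod_null hm]
    refine ae_of_all _ fun x => ?_
    have : Prod.mk x ⁻¹' {p : X × X | p.1 = p.2} = {x} := by
      ext y; simp [eq_comm]
    simp only [this, measure_singleton, Pi.zero_apply]
  rw [ae_iff]
  simpa using h

lemma IsAdmissibleInteraction.measurable_thermalKernel (hg : IsAdmissibleInteraction g) :
    Measurable (thermalKernel g C θ) :=
  hg.measurable_shiftedKernel_sub.const_mul _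

lemma IsAdmissibleInteraction.lintegral_thermalKernel_ne_top (hg : IsAdmissibleInteraction g)
    (hw : IsGibbsWeight V θ c w) :
    ∫⁻ p, thermalKernel g C θ p ∂((volume.withDensity fun x => (w x : ℝ≥0∞)).prod
      (volume.withDensity fun x => (w x : ℝ≥0∞))) ≠ ⊤ := by
  obtain ⟨W, hW⟩ := hw.withDensity_le
  simp only [thermalKernel]
  rw [lintegral_const_mul' _ _ ENNReal.ofReal_ne_top]
  exact ENNReal.mul_ne_top ENNReal.ofReal_ne_top
    (lintegral_sub_prod_ne_top hg.measurable_shiftedKernel hg.lintegral_shiftedKernel_ne_top hW hW)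

lemma IsAdmissibleInteraction.continuousAt_thermalKernel (hg : IsAdmissibleInteraction g)
    {p : Torus d T × Torus d T} (hp : p.1 ≠ p.2) : ContinuousAt (thermalKernel g C θ) p := by
  have h : ContinuousAt (fun q : Torus d T × Torus d T => shiftedKernel g C (q.1 - q.2)) p :=
    ContinuousAt.comp (f := fun q : Torus d T × Torus d T => q.1 - q.2)
      (hg.continuousAt_shiftedKernel (sub_ne_zero.2 hp))
      (continuous_fst.sub continuous_snd).continuousAt
  exact (ENNReal.continuous_const_mul ENNReal.ofReal_ne_top).continuousAt.comp h

/-- The kernel is continuous off the diagonal, and the diagonal is null because points are. For `d =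
0` the torus would be a single atom, hence `1 ≤ d`. -/
lemma IsAdmissibleInteraction.isStepApproximable_thermalKernel (hd : 1 ≤ d)
    (hg : IsAdmissibleInteraction g) (hw : IsGibbsWeight V θ c w) :
    IsStepApproximable (thermalKernel g C θ) (volume.withDensity fun x => (w x : ℝ≥0∞)) := by
  have := hw.isProbabilityMeasure
  have : Nonempty (Fin d) := ⟨⟨0, hd⟩⟩
  have : NullSingletonClass (volume : Measure (Torus d T)) := by
    rw [volume_pi]; infer_instance
  exact isStepApproximable_of_continuousAt hg.measurable_thermalKernel
    (hg.lintegral_thermalKernel_ne_top hw)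
    (measure_prod_diagonal.mono fun p hp => hg.continuousAt_thermalKernel hp)

lemma IsAdmissibleInteraction.exists_density_minimizer (hg : IsAdmissibleInteraction g)
    (hC : ∀ x, ((-C : ℝ) : EReal) ≤ g x) (hw : IsGibbsWeight V θ c w) :
    ∃ f, IsProbDensity (volume.withDensity fun x => (w x : ℝ≥0∞)) f ∧
      ∀ h, IsProbDensity (volume.withDensity fun x => (w x : ℝ≥0∞)) h →
        freeEnergy (thermalKernel g C θ) (volume.withDensity fun x => (w x : ℝ≥0∞)) f ≤
          freeEnergy (thermalKernel g C θ) (volume.withDensity fun x => (w x : ℝ≥0∞)) h := by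
  have := hw.isProbabilityMeasure
  obtain ⟨W, hW⟩ := hw.withDensity_le
  refine exists_freeEnergy_minimizer hg.measurable_thermalKernel
    (hg.lintegral_thermalKernel_ne_top hw) fun M f h hf hh hfM hhM => ?_
  have hK : ∀ a b : Torus d T → ℝ≥0,
      interactionEnergy (thermalKernel g C θ) (volume.withDensity fun x => (w x : ℝ≥0∞)) a b =
        ENNReal.ofReal θ * interactionEnergy (fun p => shiftedKernel g C (p.1 - p.2))
          (volume.withDensity fun x => (w x : ℝ≥0∞)) a b :=
    fun a b => interactionEnergy_const_mul ENNReal.ofReal_ne_top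
  simp only [hK, ← mul_add]
  refine mul_le_mul_right ?_ _
  exact hg.interactionEnergy_convex hC hW hf hh hfM hhM

/-- The Boltzmann factor of the Hamiltonian splits into pair and one-body factors. -/
lemma exp_neg_hamiltonian (hC : ∀ x, ((-C : ℝ) : EReal) ≤ g x) (hθ : 0 < θ) {N : ℕ} (hN : N ≠ 0)
    (X : Fin N → Torus d T) :
    EReal.exp (-(((θ / N : ℝ) : EReal) * hamiltonian g V N X)) =
      ENNReal.ofReal (Real.exp (θ * C * (N - 1))) *
        (boltzmann (pairEnergy (thermalKernel g C θ) N X) *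
          ENNReal.ofReal (Real.exp (-(θ * ∑ i, V (X i))))) := by
  have hN0 : (0 : ℝ) < N := by positivity
  -- The shift by `C` on `N (N - 1)` ordered pairs, weighted by `θ / N`, produces the prefactor `exp
  -- (θ C (N - 1))`.
  have hcard : (((Finset.univ : Finset (Fin N)).offDiag.card : ℕ) : ℝ) = N * (N - 1) := by
    rw [Finset.offDiag_card, Finset.card_univ, Fintype.card_fin, Nat.cast_sub (Nat.le_mul_self N)]
    push_cast; ring
  rw [pairEnergy_thermalKernel hN, hamiltonian, sum_interaction hC _ fun p : Fin N × Fin N =>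
    X p.1 - X p.2, hcard, add_assoc, ← EReal.coe_add]
  generalize ∑ p ∈ (Finset.univ : Finset (Fin N)).offDiag, shiftedKernel g C (X p.1 - X p.2) = S
  induction S using ENNReal.recTopCoe with
  | top =>
    rw [EReal.coe_ennreal_top, EReal.top_add_coe, EReal.coe_mul_top_of_pos (by positivity),
      ENNReal.mul_top (ENNReal.ofReal_pos.2 (by positivity)).ne', boltzmann]
    simp
  | coe S =>
    rw [boltzmann_of_ne_top (by finiteness), ENNReal.toReal_mul, ENNReal.coe_toReal,
      ENNReal.toReal_ofReal (by positivity),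
      show ((S : ℝ≥0∞) : EReal) = ((S : ℝ) : EReal) from rfl, ← EReal.coe_add, ← EReal.coe_mul,
      ← EReal.coe_neg, EReal.exp_coe, ← ENNReal.ofReal_mul (Real.exp_pos _).le,
      ← ENNReal.ofReal_mul (Real.exp_pos _).le, ← Real.exp_add, ← Real.exp_add]
    congr 2
    field_simp
    ring

lemma IsGibbsWeight.ofReal_exp_eq (hw : IsGibbsWeight V θ c w) {N : ℕ} (X : Fin N → Torus d T) :
    ENNReal.ofReal (Real.exp (-(θ * ∑ i, V (X i)))) =
      ENNReal.ofReal c ^ N * ∏ i, (w (X i) : ℝ≥0∞) := by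
  rw [Finset.mul_sum, ← Finset.sum_neg_distrib, Real.exp_sum,
    ENNReal.ofReal_prod_of_nonneg fun i _ => (Real.exp_pos _).le]
  have h : ∀ x, ENNReal.ofReal (Real.exp (-(θ * V x))) = ENNReal.ofReal c * (w x : ℝ≥0∞) :=
    fun x => by
    rw [← ENNReal.ofReal_coe_nnreal, ← ENNReal.ofReal_mul hw.const_pos.le, hw.coe_eq,
      mul_div_cancel₀ _ hw.const_pos.ne']
  simp only [h, Finset.prod_mul_distrib, Finset.prod_const, Finset.card_univ, Fintype.card_fin]

lemma partitionFunction_eq (hg : IsAdmissibleInteraction g) (hC : ∀ x, ((-C : ℝ) : EReal) ≤ g x)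
    (hw : IsGibbsWeight V θ c w) (hθ : 0 < θ) {N : ℕ} (hN : N ≠ 0) :
    partitionFunction g V N (θ / N) = ENNReal.ofReal (Real.exp (θ * C * (N - 1))) *
      (ENNReal.ofReal c ^ N *
        gibbsPartition (thermalKernel g C θ) (volume.withDensity fun x => (w x : ℝ≥0∞)) N) := by
  have := hw.isProbabilityMeasure
  have hb : Measurable fun X : Fin N → Torus d T =>
      boltzmann (pairEnergy (thermalKernel g C θ) N X) :=
    measurable_boltzmann.comp (measurable_pairEnergy hg.measurable_thermalKernel N)
  rw [gibbsPartition, pi_withDensity _ hw.measurable.coe_nnreal_ennreal,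
    lintegral_withDensity_eq_lintegral_mul _
      (measurable_pi_prod hw.measurable.coe_nnreal_ennreal) hb,
    ← lintegral_const_mul' _ _ (by finiteness), ← lintegral_const_mul' _ _ (by finiteness),
    partitionFunction, volume_pi]
  refine lintegral_congr fun X => ?_
  rw [exp_neg_hamiltonian hC hθ hN, hw.ofReal_exp_eq]
  simp only [Pi.mul_apply]
  ring

/-- Strictness on all of `[0, ∞]`, including `⊤`, lets minimality pass in both directions between
the free energy and the thermal energy. -/
lemma strictMono_mul_add_coe (hθ : 0 < θ) (r : ℝ) :
    StrictMono fun a : ℝ≥0∞ => ((1 / θ : ℝ) : EReal) * (a : EReal) + (r : EReal) := by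
  intro a b hab
  lift a to ℝ≥0 using hab.ne_top
  have ha : (((a : ℝ≥0) : ℝ≥0∞) : EReal) = ((a : ℝ) : EReal) := rfl
  induction b using ENNReal.recTopCoe with
  | top =>
    simp only [ha]
    rw [EReal.coe_ennreal_top, EReal.coe_mul_top_of_pos (by positivity), EReal.top_add_coe,
      ← EReal.coe_mul, ← EReal.coe_add]
    exact EReal.coe_lt_top _
  | coe b =>
    have hb : (((b : ℝ≥0) : ℝ≥0∞) : EReal) = ((b : ℝ) : EReal) := rfl
    have hlt : (a : ℝ) < b := by exact_mod_cast hab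
    simp only [ha, hb, ← EReal.coe_mul, ← EReal.coe_add, EReal.coe_lt_coe_iff]
    gcongr

/-- The minimizing density of the free energy yields a thermal equilibrium measure. -/
lemma exists_isThermalEquilibrium (hg : IsAdmissibleInteraction g)
    (hC : ∀ x, ((-C : ℝ) : EReal) ≤ g x) (hV : IsAdmissiblePotential V) (hθ : 0 < θ)
    (hw : IsGibbsWeight V θ c w) : ∃ μ, IsThermalEquilibrium g V θ μ := by
  have := hw.isProbabilityMeasure
  obtain ⟨f, hf, hmin⟩ := hg.exists_density_minimizer hC hw
  refine ⟨⟨_, hf.isProbabilityMeasure⟩, fun ν => ?_⟩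
  rw [ProbabilityMeasure.coe_mk]
  by_cases hν : (ν : Measure (Torus d T)) ≪ volume
  · obtain ⟨h, hh, hνh⟩ := exists_density_of_absolutelyContinuous
      (hν.trans hw.absolutelyContinuous)
    rw [thermalEnergy_eq_freeEnergy hg hC hV hθ hw hh hνh,
      thermalEnergy_eq_freeEnergy hg hC hV hθ hw hf rfl]
    exact (strictMono_mul_add_coe hθ _).monotone (hmin h hh)
  · rw [thermalEnergy_of_not_absolutelyContinuous hg hV hθ ν hν]
    exact le_top

/-- The density of a thermal equilibrium measure minimizes the free energy. -/
lemma IsThermalEquilibrium.exists_density (hg : IsAdmissibleInteraction g)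
    (hC : ∀ x, ((-C : ℝ) : EReal) ≤ g x) (hV : IsAdmissiblePotential V) (hθ : 0 < θ)
    (hw : IsGibbsWeight V θ c w) {μ : ProbabilityMeasure (Torus d T)}
    (hμ : IsThermalEquilibrium g V θ μ) :
    ∃ f, IsProbDensity (volume.withDensity fun x => (w x : ℝ≥0∞)) f ∧
      (μ : Measure (Torus d T)) = (volume.withDensity fun x => (w x : ℝ≥0∞)).withDensity
        (fun x => (f x : ℝ≥0∞)) ∧
      freeEnergy (thermalKernel g C θ) (volume.withDensity fun x => (w x : ℝ≥0∞)) f ≠ ⊤ ∧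
      ∀ h, IsProbDensity (volume.withDensity fun x => (w x : ℝ≥0∞)) h →
        freeEnergy (thermalKernel g C θ) (volume.withDensity fun x => (w x : ℝ≥0∞)) f ≤
          freeEnergy (thermalKernel g C θ) (volume.withDensity fun x => (w x : ℝ≥0∞)) h := by
  have := hw.isProbabilityMeasure
  have hle : ∀ h, IsProbDensity (volume.withDensity fun x => (w x : ℝ≥0∞)) h →
      thermalEnergy g V θ (μ : Measure (Torus d T)) ≤ ((1 / θ : ℝ) : EReal) *
        (freeEnergy (thermalKernel g C θ) (volume.withDensity fun x => (w x : ℝ≥0∞)) h : EReal) +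
          ((-C - Real.log c / θ : ℝ) : EReal) := fun h hh => by
    rw [← thermalEnergy_eq_freeEnergy hg hC hV hθ hw hh rfl]
    exact hμ ⟨_, hh.isProbabilityMeasure⟩
  -- The Gibbs weight itself, of density one, has finite free energy. A minimizer therefore has
  -- energy below `⊤` and must be absolutely continuous.
  have hone : freeEnergy (thermalKernel g C θ) (volume.withDensity fun x => (w x : ℝ≥0∞))
      (fun _ => 1) < ⊤ := by
    rw [freeEnergy_one]
    exact (hg.lintegral_thermalKernel_ne_top hw).lt_top
  have hac : (μ : Measure (Torus d T)) ≪ volume := by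
    by_contra hcon
    have h1 := (hle _ isProbDensity_one).trans_lt (strictMono_mul_add_coe hθ _ hone)
    rw [thermalEnergy_of_not_absolutelyContinuous hg hV hθ μ hcon] at h1
    exact not_top_lt h1
  obtain ⟨f, hf, hμf⟩ := exists_density_of_absolutelyContinuous (hac.trans hw.absolutelyContinuous)
  rw [thermalEnergy_eq_freeEnergy hg hC hV hθ hw hf hμf] at hle
  have hmin := fun h hh => (strictMono_mul_add_coe hθ (-C - Real.log c / θ)).le_iff_le.1 (hle h hh)
  exact ⟨f, hf, hμf, ((hmin _ isProbDensity_one).trans_lt hone).ne, hmin⟩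

end PartitionFunction

/-! ### The next-order partition function -/

theorem proposition5p3 (d : ℕ) (hd : 1 ≤ d) (T : ℝ) [Fact (0 < T)]
    (g : Torus d T → EReal) (hg : IsAdmissibleInteraction g)
    (V : Torus d T → ℝ) (hV : IsAdmissiblePotential V)
    (θ : ℝ) (hθ : 0 < θ) :
    (∃ μθ : ProbabilityMeasure (Torus d T), IsThermalEquilibrium g V θ μθ) ∧
      ∀ μθ : ProbabilityMeasure (Torus d T), IsThermalEquilibrium g V θ μθ →
        Tendsto
          (fun N : ℕ =>
            ENNReal.log (nextOrderPartitionFunction g V μθ N (θ / N)) / ((N : ℝ) : EReal))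
          atTop (𝓝 (0 : EReal)) := by
  obtain ⟨C, hC⟩ := hg.exists_lower_bound
  obtain ⟨c, w, hw⟩ := hV.exists_gibbsWeight hθ
  refine ⟨exists_isThermalEquilibrium hg hC hV hθ hw, fun μ hμ => ?_⟩
  have := hw.isProbabilityMeasure
  obtain ⟨f, hf, hμf, hfin, hmin⟩ := hμ.exists_density hg hC hV hθ hw
  set π := volume.withDensity fun x => (w x : ℝ≥0∞)
  set k := thermalKernel g C θ
  set F := (freeEnergy k π f).toReal
  have hk : Measurable k := hg.measurable_thermalKernel
  have hlim := tendsto_log_gibbsPartition hk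
    (hg.isStepApproximable_thermalKernel hd hw) hf hfin hmin
  have henergy : thermalEnergy g V θ (μ : Measure (Torus d T)) =
      ((1 / θ * F + (-C - Real.log c / θ) : ℝ) : EReal) := by
    rw [thermalEnergy_eq_freeEnergy hg hC hV hθ hw hf hμf, EReal.coe_add, EReal.coe_mul,
      EReal.coe_ennreal_toReal hfin]
  -- With `β = θ / N` one has `N² β = N θ`, so the factors `c ^ N` and `exp (θ C N)` cancel against
  -- the constant in the thermal energy. What is left besides `log G + N F` is `-θ C`, from having
  -- `N - 1` instead of `N`.
  have hlog : ∀ N : ℕ, N ≠ 0 →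
      ENNReal.log (nextOrderPartitionFunction g V μ N (θ / N)) / ((N : ℝ) : EReal) =
        ((-(θ * C) * (N : ℝ)⁻¹ + Real.log (gibbsPartition k π N).toReal / N + F : ℝ) : EReal) := by
    intro N hN
    have hN0 : (0 : ℝ) < N := by positivity
    have hGpos := gibbsPartition_pos hk hf hfin hN
    have hGtop : gibbsPartition k π N ≠ ⊤ :=
      ((gibbsPartition_le_one N).trans_lt ENNReal.one_lt_top).ne
    obtain ⟨G, hG⟩ : ∃ G : ℝ, G = (gibbsPartition k π N).toReal := ⟨_, rfl⟩
    rw [← hG] at hGpos ⊢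
    rw [nextOrderPartitionFunction, partitionFunction_eq hg hC hw hθ hN,
      mul_div_cancel₀ θ hN0.ne', henergy, ← EReal.coe_mul, ← EReal.coe_neg, EReal.exp_coe,
      ← ENNReal.ofReal_toReal hGtop, ← hG, ← ENNReal.ofReal_pow hw.const_pos.le,
      ← ENNReal.ofReal_mul (by have := hw.const_pos; positivity),
      ← ENNReal.ofReal_mul (Real.exp_pos _).le,
      ← ENNReal.ofReal_div_of_pos (Real.exp_pos _), ENNReal.log_ofReal_of_pos
        (by have := hw.const_pos; positivity), ← EReal.coe_div]
    congr 1
    rw [Real.log_div (by have := hw.const_pos; positivity) (Real.exp_pos _).ne', Real.log_exp,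
      Real.log_mul (Real.exp_pos _).ne' (by have := hw.const_pos; positivity), Real.log_exp,
      Real.log_mul (by have := hw.const_pos; positivity) hGpos.ne', Real.log_pow]
    field_simp
    ring
  have hreal : Tendsto (fun N : ℕ =>
      -(θ * C) * (N : ℝ)⁻¹ + Real.log (gibbsPartition k π N).toReal / N + F) atTop (𝓝 0) := by
    have h := ((tendsto_inv_atTop_nhds_zero_nat (𝕜 := ℝ)).const_mul (-(θ * C))).add hlim
    have h' := h.add_const F
    rw [mul_zero, zero_add, neg_add_cancel] at h'
    exact h'
  have h0 := (continuous_coe_real_ereal.tendsto (0 : ℝ)).comp hreal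
  refine Tendsto.congr' ?_ h0
  filter_upwards [eventually_ne_atTop 0] with N hN
  exact (hlog N hN).symm
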